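/- Let $\Bbbk$ be a field of characteristic zero. Let $\mathsf{CoCom}$ denote the category of counital cocommutative $\Bbbk$-coalgebras $C$ that are conilpotent (so $C$ has a canonical coaugmentation $\Bbbk\to C$, given by the unique group-like element $1\in C$) and of finite type, meaning that the space of primitives $\mathrm{Prim}(C)=\{x : \Delta x=x\otimes 1+1\otimes x\}$ is finite-dimensional; morphisms are all counital coalgebra morphisms. For such $C$ the linear dual $\Bbbk[C]=C^\vee$ is a commutative local algebra whose maximal ideal $\mathfrak m_C$ consists of the functionals vanishing at $1$. A morphism $f\colon C\to D$ is a formal submersion if $f^\vee\colon \Bbbk[D]\to\Bbbk[C]$ is formally smooth for the $\mathfrak m_D$-adic and $\mathfrak m_C$-adic topologies: for every discrete commutative ring $A$ and ideal $N\subseteq A$ with $N^2=0$, every commutative square of continuous ring homomorphisms from $f^\vee$ to $A\to A/N$ has a continuous diagonal filler $\Bbbk[C]\to A$. A coalgebra $C$ is a pointed formal manifold if its counit $C\to\Bbbk$ is a formal submersion. For a finite-dimensional vector space $V$, let $\mathrm{Sym}^{\mathrm{co}}(V)$ be the symmetric coalgebra: the symmetric algebra of $V$ with the multiplicative comultiplication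 for which the elements of $V$ are primitive. 1. The category $\mathsf{CoCom}$ with the class $\mathcal S_{fs}$ of formal submersions is a descent category. That is, $\mathcal S_{fs}$ is a subcategory (it contains all identities and is closed under composition), and: (i) $\mathsf{CoCom}$ has all finite limits; (ii) the unique map from the terminal object to itself is in $\mathcal S_{fs}$; (iii) $\mathcal S_{fs}$ is closed under base change along arbitrary morphisms; (iv) if $f$ and $g\circ f$ are in $\mathcal S_{fs}$, then so is $g$; (v) every morphism in $\mathcal S_{fs}$ is an effective epimorphism, i.e. has a kernel pair and is the coequalizer of it. 2. If $f\colon C\to D$ is a formal submersion, then $\mathrm{Prim}(f)\colon\mathrm{Prim}(C)\to\mathrm{Prim}(D)$ is surjective. 3. A coalgebra $C\in\mathsf{CoCom}$ is a pointed formal manifold if and only if there is a finite-dimensional vector space $V$ with $C\cong\mathrm{Sym}^{\mathrm{co}}(V)$. Here $\mathrm{Sym}^{\mathrm{co}}(V)$ is the cofree conilpotent cocommutative coalgebra cogenerated by $V$: for every conilpotent cocommutative coalgebra $D$, each linear map $\varphi\colon D\to V$ with $\varphi(1)=0$ lifts along the projection $\mathrm{Sym}^{\mathrm{co}}(V)\to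 V$ to a unique coalgebra morphism $D\to\mathrm{Sym}^{\mathrm{co}}(V)$. 4. If $f\colon C\to D$ is a morphism between pointed formal manifolds and $\mathrm{Prim}(f)$ is surjective, then $f$ is a formal submersion. -/

import Mathlib

open CategoryTheory CategoryTheory.Limits
open scoped TensorProduct

universe u

noncomputable section

namespace FormalCoalg

/-! ### Conilpotent coalgebras and primitive elements -/

section Basic

variable {k C D : Type u} [Field k]
  [AddCommGroup C] [Module k C] [Coalgebra k C] [AddCommGroup D] [Module k D] [Coalgebra k D]

/-- The reduced comultiplication `x ↦ Δ x - x ⊗ e - e ⊗ x` of a coalgebra with base point `e`. -/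
def reducedComul (k : Type u) [Field k] [Module k C] [Coalgebra k C] (e : C) : C →ₗ[k] C ⊗[k] C :=
  Coalgebra.comul - (TensorProduct.mk k C C).flip e - TensorProduct.mk k C C e

/-- The primitive elements `{x | Δ x = x ⊗ e + e ⊗ x}`. -/
def primitives (k : Type u) [Field k] [Module k C] [Coalgebra k C] (e : C) : Submodule k C :=
  LinearMap.ker (reducedComul k e)

/-- The primitive filtration: `F₀ = k e` and
`Fₙ₊₁ = {x | Δ x - x ⊗ e - e ⊗ x ∈ Fₙ ⊗ Fₙ}`. -/
def primFiltration (k : Type u) [Field k] [Module k C] [Coalgebra k C] (e : C) :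
    ℕ → Submodule k C
  | 0 => Submodule.span k {e}
  | n + 1 => Submodule.comap (reducedComul k e)
      (LinearMap.range (TensorProduct.map (primFiltration k e n).subtype
        (primFiltration k e n).subtype))

/-- `C` is conilpotent (connected) with coaugmentation `k → C`, `1 ↦ e`: the element `e` is
group-like and the primitive filtration is exhaustive. -/
structure IsConilpotent (k : Type u) [Field k] [Module k C] [Coalgebra k C] (e : C) : Prop where
  isGroupLike : IsGroupLikeElem k e
  exhaustive : ∀ x : C, ∃ n, x ∈ primFiltration k e n

theorem reducedComul_apply (e x : C) :
    reducedComul k e x = Coalgebra.comul (R := k) x - x ⊗ₜ[k] e - e ⊗ₜ[k] x := by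
  simp [reducedComul]

theorem mem_primitives {e x : C} :
    x ∈ primitives k e ↔ Coalgebra.comul (R := k) x = x ⊗ₜ[k] e + e ⊗ₜ[k] x := by
  rw [primitives, LinearMap.mem_ker, reducedComul_apply, sub_sub, sub_eq_zero]

theorem mem_of_tmul_self_mem {C : Type u} [AddCommGroup C] [Module k C] (F : Submodule k C) (x : C)
    (h : x ⊗ₜ[k] x ∈ LinearMap.range (TensorProduct.map F.subtype F.subtype)) : x ∈ F := by
  by_contra hx
  obtain ⟨f, hf, hF⟩ := Submodule.exists_le_ker_of_notMem hx
  obtain ⟨t, ht⟩ := h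
  have h0 : (TensorProduct.map f f) ∘ₗ (TensorProduct.map F.subtype F.subtype) = 0 := by
    rw [← TensorProduct.map_comp]
    have : f ∘ₗ F.subtype = 0 := by
      ext y; exact hF y.2
    rw [this, TensorProduct.map_zero_left]
  have h1 : TensorProduct.map f f (x ⊗ₜ[k] x) = 0 := by
    rw [← ht, ← LinearMap.comp_apply, h0]; rfl
  rw [TensorProduct.map_tmul] at h1
  have h2 := congrArg (TensorProduct.lid k k) h1
  simp at h2
  exact hf h2

/-- A conilpotent coalgebra has only one group-like element. -/
theorem IsConilpotent.eq_of_isGroupLike {e g : C} (he : IsConilpotent k e)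
    (hg : IsGroupLikeElem k g) : g = e := by
  have hred : reducedComul k e (g - e) = (g - e) ⊗ₜ[k] (g - e) := by
    rw [reducedComul_apply, map_sub, hg.comul_eq_tmul_self, he.isGroupLike.comul_eq_tmul_self]
    simp only [TensorProduct.sub_tmul, TensorProduct.tmul_sub]
    abel
  have key : ∀ n, g - e ∈ primFiltration k e n → g - e = 0 := by
    intro n
    induction n with
    | zero =>
      intro h
      obtain ⟨c, hc⟩ := Submodule.mem_span_singleton.1 h
      have h1 := congrArg (Coalgebra.counit (R := k)) hc
      rw [map_smul, map_sub, hg.counit_eq_one, he.isGroupLike.counit_eq_one] at h1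
      simp at h1
      rw [← hc, h1, zero_smul]
    | succ n ih =>
      intro h
      refine ih (mem_of_tmul_self_mem _ _ ?_)
      rw [← hred]
      exact h
  obtain ⟨n, hn⟩ := he.exhaustive (g - e)
  exact sub_eq_zero.1 (key n hn)

end Basic

/-! ### The category of finite-type conilpotent cocommutative coalgebras -/

/-- Finite-type conilpotent counital cocommutative coalgebras over `k`. The point `pt` is the
image of `1` under the coaugmentation; it is the unique group-like element. -/
structure CoCom (k : Type u) [Field k] : Type (u + 1) where
  carrier : Type u
  [addCommGroup : AddCommGroup carrier]
  [module : Module k carrier]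
  [coalgebra : Coalgebra k carrier]
  [isCocomm : Coalgebra.IsCocomm k carrier]
  pt : carrier
  isConilpotent : IsConilpotent k pt
  finiteType : Module.Finite k (primitives k pt)

attribute [instance] CoCom.addCommGroup CoCom.module CoCom.coalgebra CoCom.isCocomm

variable {k : Type u} [Field k]

/-- Morphisms are all (counital) coalgebra morphisms. -/
@[ext]
structure CoCom.Hom (C D : CoCom k) : Type u where
  hom : C.carrier →ₗc[k] D.carrier

instance : Category (CoCom k) where
  Hom C D := CoCom.Hom C D
  id C := ⟨CoalgHom.id k C.carrier⟩
  comp f g := ⟨g.hom.comp f.hom⟩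

theorem CoCom.Hom.map_pt {C D : CoCom k} (f : C ⟶ D) : f.hom C.pt = D.pt :=
  D.isConilpotent.eq_of_isGroupLike (C.isConilpotent.isGroupLike.map f.hom)

/-- The space `Prim(C)` of primitive elements. -/
abbrev Prim (C : CoCom k) : Submodule k C.carrier := primitives k C.pt

/-- The linear map `Prim(f) : Prim(C) → Prim(D)`. -/
def Prim.map {C D : CoCom k} (f : C ⟶ D) : Prim C →ₗ[k] Prim D :=
  (f.hom : C.carrier →ₗ[k] D.carrier).restrict (fun x hx => by
    rw [mem_primitives] at hx ⊢
    have h := CoalgHomClass.map_comp_comul_apply f.hom x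
    rw [hx] at h
    simpa [CoCom.Hom.map_pt] using h.symm)

/-! ### The dual algebra and formal submersions -/

/-- The algebra of functions `k[C] = C^∨`: the full linear dual with the convolution product. -/
abbrev FunAlg (C : CoCom k) : Type u := WithConv (C.carrier →ₗ[k] k)

/-- The maximal ideal of `k[C]`: the functions vanishing at the base point, i.e. the kernel of the
augmentation dual to the coaugmentation. -/
def FunAlg.maxIdeal (C : CoCom k) : Ideal (FunAlg C) where
  carrier := {f | f.ofConv C.pt = 0}
  add_mem' {f g} hf hg := by
    simp only [Set.mem_ofPred_eq] at hf hg ⊢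
    simp [hf, hg]
  zero_mem' := by simp
  smul_mem' f g hg := by
    simp only [Set.mem_ofPred_eq] at hg ⊢
    simp [LinearMap.convMul_def, C.isConilpotent.isGroupLike.comul_eq_tmul_self, hg]

/-- The algebra morphism `f^∨ : k[D] → k[C]`, precomposition with `f`. -/
def FunAlg.map {C D : CoCom k} (f : C ⟶ D) : FunAlg D →+* FunAlg C where
  toFun φ := WithConv.toConv (φ.ofConv ∘ₗ (f.hom : C.carrier →ₗ[k] D.carrier))
  map_one' := by
    ext x
    simp [LinearMap.convOne_def]
  map_mul' φ ψ := by
    exact congrArg WithConv.toConv (LinearMap.convMul_comp_coalgHom_distrib φ ψ f.hom)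
  map_zero' := by ext x; simp
  map_add' φ ψ := by ext x; simp

/-- Formal smoothness of a homomorphism `φ : R → S` of topological rings carrying the `I`-adic and
the `J`-adic topology: for every discrete ring `A` and square-zero ideal `N` of `A`, every
commutative square of continuous ring homomorphisms from `φ` to `A → A / N` has a continuous
diagonal filler. A homomorphism to a discrete ring is continuous iff it kills a power of the
ideal that defines the topology. -/
def IsFormallySmoothAdic {R S : Type u} [CommRing R] [CommRing S] (I : Ideal R) (J : Ideal S)
    (φ : R →+* S) : Prop :=
  ∀ (A : Type u) [CommRing A] (N : Ideal A), N ^ 2 = ⊥ →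
    ∀ (α : R →+* A) (β : S →+* A ⧸ N),
      (∃ n : ℕ, I ^ n ≤ RingHom.ker α) → (∃ n : ℕ, J ^ n ≤ RingHom.ker β) →
      (Ideal.Quotient.mk N).comp α = β.comp φ →
      ∃ γ : S →+* A, (∃ n : ℕ, J ^ n ≤ RingHom.ker γ) ∧
        γ.comp φ = α ∧ (Ideal.Quotient.mk N).comp γ = β

/-- `f : C → D` is a formal submersion if `f^∨ : k[D] → k[C]` is formally smooth for the
topologies defined by the maximal ideals. -/
def IsFormalSubmersion {C D : CoCom k} (f : C ⟶ D) : Prop :=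
  IsFormallySmoothAdic (FunAlg.maxIdeal D) (FunAlg.maxIdeal C) (FunAlg.map f)

/-- The class of formal submersions. -/
def formalSubmersions (k : Type u) [Field k] : MorphismProperty (CoCom k) :=
  fun _ _ f => IsFormalSubmersion f

/-- The ground field as an object. -/
def CoCom.ground (k : Type u) [Field k] : CoCom k where
  carrier := k
  pt := 1
  isConilpotent :=
    { isGroupLike := isGroupLikeElem_self.2 rfl
      exhaustive := fun x => ⟨0, Submodule.mem_span_singleton.2 ⟨x, by simp⟩⟩ }
  finiteType := inferInstance

/-- The counit `C → k` as a morphism. -/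
def CoCom.counit (C : CoCom k) : C ⟶ CoCom.ground k :=
  CoCom.Hom.mk (C := C) (D := CoCom.ground k) (Coalgebra.counitCoalgHom k C.carrier)

/-- `C` is a pointed formal manifold if its counit is a formal submersion. -/
def IsFormalManifold (C : CoCom k) : Prop := IsFormalSubmersion C.counit

/-! ### Descent categories -/

/-- A morphism is an effective epimorphism if it has a kernel pair and is its coequalizer. -/
def IsEffectiveEpimorphism {𝒟 : Type*} [Category 𝒟] {X Y : 𝒟} (f : X ⟶ Y) : Prop :=
  ∃ (R : 𝒟) (p q : R ⟶ X) (h : IsKernelPair f p q), Nonempty (IsColimit (Cofork.ofπ f h.w))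

/-- A (subcanonical) descent category: a category with a subcategory `S` of covers. -/
structure IsDescentCategory (𝒟 : Type*) [Category 𝒟] (S : MorphismProperty 𝒟) : Prop where
  /-- the covers form a subcategory -/
  isMultiplicative : S.IsMultiplicative
  hasFiniteLimits : HasFiniteLimits 𝒟
  terminal : ∀ (T : 𝒟), IsTerminal T → S (𝟙 T)
  baseChange : S.IsStableUnderBaseChange
  cancel : ∀ {X Y Z : 𝒟} (f : X ⟶ Y) (g : Y ⟶ Z), S f → S (f ≫ g) → S g
  effective : ∀ {X Y : 𝒟} (f : X ⟶ Y), S f → IsEffectiveEpimorphism f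

/-! ### The symmetric coalgebra -/

section Sym

variable (k) (V : Type u) [AddCommGroup V] [Module k V]

/-- The projection `Sym(V) → V` onto the summand of degree one. -/
def symProj : SymmetricAlgebra k V →ₗ[k] V := by
  letI : Module kᵐᵒᵖ V := Module.compHom _ ((RingHom.id k).fromOpposite mul_comm)
  haveI : IsCentralScalar k V := ⟨fun r m => rfl⟩
  exact (TrivSqZeroExt.sndHom k V).comp
    (SymmetricAlgebra.lift (TrivSqZeroExt.inrHom k V)).toLinearMap

theorem symProj_ι (v : V) : symProj k V (SymmetricAlgebra.ι k V v) = v := by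
  simp [symProj]

theorem symProj_one : symProj k V 1 = 0 := by
  let : Module kᵐᵒᵖ V := Module.compHom _ ((RingHom.id k).fromOpposite mul_comm)
  have : IsCentralScalar k V := ⟨fun r m => rfl⟩
  exact congrArg TrivSqZeroExt.snd
    (map_one (SymmetricAlgebra.lift (TrivSqZeroExt.inrHom k V)))

variable {V}

theorem tmul_mem_range_map {M : Type u} [AddCommGroup M] [Module k M] (F : Submodule k M) {a b : M}
    (ha : a ∈ F) (hb : b ∈ F) :
    a ⊗ₜ[k] b ∈ LinearMap.range (TensorProduct.map F.subtype F.subtype) :=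
  ⟨⟨a, ha⟩ ⊗ₜ ⟨b, hb⟩, by simp⟩

theorem range_map_le {M : Type u} [AddCommGroup M] [Module k M] (F : Submodule k M)
    (P : Submodule k (M ⊗[k] M)) (h : ∀ a ∈ F, ∀ b ∈ F, a ⊗ₜ[k] b ∈ P) :
    LinearMap.range (TensorProduct.map F.subtype F.subtype) ≤ P := by
  rintro _ ⟨t, rfl⟩
  induction t with
  | zero => simp
  | add x y hx hy => rw [map_add]; exact P.add_mem hx hy
  | tmul a b => rw [TensorProduct.map_tmul]; exact h _ a.2 _ b.2

variable (V)

/-- The elements of the symmetric algebra of degree at most `n`. -/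
def symFil (n : ℕ) : Submodule k (SymmetricAlgebra k V) :=
  (1 ⊔ LinearMap.range (SymmetricAlgebra.ι k V)) ^ n

theorem symFil_mono {m n : ℕ} (h : m ≤ n) : symFil k V m ≤ symFil k V n :=
  pow_le_pow_right' le_sup_left h

theorem ι_mem_symFil (v : V) : SymmetricAlgebra.ι k V v ∈ symFil k V 1 := by
  rw [symFil, pow_one]
  exact Submodule.mem_sup_right ⟨v, rfl⟩

theorem symFil_mul_mem {n : ℕ} {a : SymmetricAlgebra k V} (ha : a ∈ symFil k V n) (v : V) :
    a * SymmetricAlgebra.ι k V v ∈ symFil k V (n + 1) := by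
  have := ι_mem_symFil k V v
  rw [symFil, pow_one] at this
  rw [symFil, pow_succ]
  exact Submodule.mul_mem_mul ha this

theorem reducedComul_mul_ι (x : SymmetricAlgebra k V) (v : V) :
    reducedComul k 1 (x * SymmetricAlgebra.ι k V v) =
      x ⊗ₜ[k] SymmetricAlgebra.ι k V v + SymmetricAlgebra.ι k V v ⊗ₜ[k] x +
      (reducedComul k 1 x * (SymmetricAlgebra.ι k V v ⊗ₜ[k] 1) +
        reducedComul k 1 x * (1 ⊗ₜ[k] SymmetricAlgebra.ι k V v)) := by
  simp only [reducedComul_apply, Bialgebra.comul_mul, SymmetricAlgebra.comul_ι, mul_add, sub_mul,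
    Algebra.TensorProduct.tmul_mul_tmul, mul_one, one_mul]
  abel

theorem reducedComul_mem (n : ℕ) (x : SymmetricAlgebra k V) (hx : x ∈ symFil k V (n + 1)) :
    reducedComul k 1 x ∈
      LinearMap.range (TensorProduct.map (symFil k V n).subtype (symFil k V n).subtype) := by
  have one_mem : ∀ n, (1 : SymmetricAlgebra k V) ∈ symFil k V n := fun n =>
    symFil_mono k V (Nat.zero_le n) (by rw [symFil, pow_zero]; exact Submodule.one_le.1 le_rfl)
  have mono : ∀ n, LinearMap.range
        (TensorProduct.map (symFil k V n).subtype (symFil k V n).subtype) ≤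
      LinearMap.range
        (TensorProduct.map (symFil k V (n + 1)).subtype (symFil k V (n + 1)).subtype) :=
    fun n => range_map_le k _ _ fun a ha b hb =>
      tmul_mem_range_map k _ (symFil_mono k V n.le_succ ha) (symFil_mono k V n.le_succ hb)
  induction n generalizing x with
  | zero =>
    rw [symFil, zero_add, pow_one] at hx
    obtain ⟨y, hy, z, ⟨v, rfl⟩, rfl⟩ := Submodule.mem_sup.1 hx
    obtain ⟨c, rfl⟩ := Submodule.mem_one.1 hy
    rw [map_add]
    refine Submodule.add_mem _ ?_ ?_
    · rw [Algebra.algebraMap_eq_smul_one, map_smul, reducedComul_apply, Bialgebra.comul_one,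
        Algebra.TensorProduct.one_def, sub_self, zero_sub]
      exact Submodule.smul_mem _ _
        (Submodule.neg_mem _ (tmul_mem_range_map k _ (one_mem 0) (one_mem 0)))
    · rw [reducedComul_apply, SymmetricAlgebra.comul_ι, sub_sub, sub_self]
      exact Submodule.zero_mem _
  | succ n ih =>
    rw [symFil, pow_succ] at hx
    refine Submodule.mul_induction_on hx ?_ ?_
    · intro a ha y hy
      obtain ⟨y, hy', z, ⟨v, rfl⟩, rfl⟩ := Submodule.mem_sup.1 hy
      obtain ⟨c, rfl⟩ := Submodule.mem_one.1 hy'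
      have hr := ih a ha
      rw [mul_add, map_add]
      refine Submodule.add_mem _ ?_ ?_
      · rw [mul_comm, ← Algebra.smul_def, map_smul]
        exact Submodule.smul_mem _ _ (mono n hr)
      · rw [reducedComul_mul_ι]
        have hv : SymmetricAlgebra.ι k V v ∈ symFil k V (n + 1) :=
          symFil_mono k V (Nat.succ_le_succ n.zero_le) (ι_mem_symFil k V v)
        refine Submodule.add_mem _ (Submodule.add_mem _ (tmul_mem_range_map k _ ha hv)
          (tmul_mem_range_map k _ hv ha)) (Submodule.add_mem _ ?_ ?_)
        · refine range_map_le k _ (Submodule.comap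
            (LinearMap.mulRight k (SymmetricAlgebra.ι k V v ⊗ₜ[k] 1))
            (LinearMap.range (TensorProduct.map _ _))) ?_ hr
          intro b hb c hc
          rw [Submodule.mem_comap, LinearMap.mulRight_apply,
            Algebra.TensorProduct.tmul_mul_tmul, mul_one]
          exact tmul_mem_range_map k _ (symFil_mul_mem k V hb v) (symFil_mono k V n.le_succ hc)
        · refine range_map_le k _ (Submodule.comap
            (LinearMap.mulRight k (1 ⊗ₜ[k] SymmetricAlgebra.ι k V v))
            (LinearMap.range (TensorProduct.map _ _))) ?_ hr
          intro b hb c hc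
          rw [Submodule.mem_comap, LinearMap.mulRight_apply,
            Algebra.TensorProduct.tmul_mul_tmul, mul_one]
          exact tmul_mem_range_map k _ (symFil_mono k V n.le_succ hb) (symFil_mul_mem k V hc v)
    · intro a b ha hb
      rw [map_add]
      exact Submodule.add_mem _ ha hb

theorem symFil_le (n : ℕ) :
    symFil k V n ≤ primFiltration k (1 : SymmetricAlgebra k V) n := by
  induction n with
  | zero => rw [symFil, pow_zero, primFiltration, Submodule.one_eq_span]
  | succ n ih =>
    intro x hx
    exact range_map_le k _ _ (fun a ha b hb => tmul_mem_range_map k _ (ih ha) (ih hb))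
      (reducedComul_mem k V n x hx)

theorem exists_mem_symFil (x : SymmetricAlgebra k V) : ∃ n, x ∈ symFil k V n := by
  induction x using SymmetricAlgebra.induction with
  | algebraMap r => exact ⟨0, by rw [symFil, pow_zero]; exact Submodule.mem_one.2 ⟨r, rfl⟩⟩
  | ι v => exact ⟨1, ι_mem_symFil k V v⟩
  | mul a b ha hb =>
    obtain ⟨m, hm⟩ := ha
    obtain ⟨n, hn⟩ := hb
    exact ⟨m + n, by rw [symFil, pow_add]; exact Submodule.mul_mem_mul hm hn⟩
  | add a b ha hb =>
    obtain ⟨m, hm⟩ := ha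
    obtain ⟨n, hn⟩ := hb
    exact ⟨max m n, Submodule.add_mem _ (symFil_mono k V (le_max_left _ _) hm)
      (symFil_mono k V (le_max_right _ _) hn)⟩

theorem isConilpotent_sym : IsConilpotent k (1 : SymmetricAlgebra k V) where
  isGroupLike := ⟨Bialgebra.counit_one, by
    rw [Bialgebra.comul_one, Algebra.TensorProduct.one_def]⟩
  exhaustive x := by
    obtain ⟨n, hn⟩ := exists_mem_symFil k V x
    exact ⟨n, symFil_le k V n hn⟩

theorem primitives_sym_le [CharZero k] :
    primitives k (1 : SymmetricAlgebra k V) ≤ LinearMap.range (SymmetricAlgebra.ι k V) := by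
  intro x hx
  let L := LinearMap.range (SymmetricAlgebra.ι k V)
  let Ψ : SymmetricAlgebra k V →ₐ[k] SymmetricAlgebra k V :=
    (Algebra.TensorProduct.lmul' k).comp (Bialgebra.comulAlgHom k (SymmetricAlgebra k V))
  let E : ℕ → Submodule k (SymmetricAlgebra k V) := fun n =>
    Module.End.eigenspace Ψ.toLinearMap ((2 : k) ^ n)
  have hΨ : ∀ v, Ψ (SymmetricAlgebra.ι k V v) = (2 : k) • SymmetricAlgebra.ι k V v := by
    intro v
    simp [Ψ, two_smul]
  have hLE : ∀ n, L ^ n ≤ E n := by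
    intro n
    induction n with
    | zero =>
      intro y hy
      rw [pow_zero] at hy
      obtain ⟨c, rfl⟩ := Submodule.mem_one.1 hy
      simp [E]
    | succ n ih =>
      rw [pow_succ, Submodule.mul_le]
      rintro a ha _ ⟨v, rfl⟩
      have h1 : Ψ a = (2 : k) ^ n • a := Module.End.mem_eigenspace_iff.1 (ih ha)
      refine Module.End.mem_eigenspace_iff.2 ?_
      rw [AlgHom.toLinearMap_apply, map_mul, h1, hΨ, smul_mul_smul_comm, pow_succ]
  have hind : iSupIndep E :=
    (Module.End.eigenspaces_iSupIndep Ψ.toLinearMap).comp (f := fun n : ℕ => (2 : k) ^ n)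
      (fun m n h => Nat.pow_right_injective le_rfl (by
        have h' : (2 : k) ^ m = (2 : k) ^ n := h
        exact_mod_cast h'))
  have htop : ∀ y : SymmetricAlgebra k V, y ∈ ⨆ n, L ^ n := by
    intro y
    obtain ⟨n, hn⟩ := exists_mem_symFil k V y
    have hle : ∀ n, symFil k V n ≤ ⨆ n, L ^ n := by
      intro n
      induction n with
      | zero => exact le_iSup_of_le 0 (by rw [symFil, pow_zero, pow_zero])
      | succ n ih =>
        rw [symFil, pow_succ]
        refine (mul_le_mul' ih (le_refl (1 ⊔ L))).trans ?_
        rw [Submodule.mul_sup, mul_one, Submodule.iSup_mul]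
        refine sup_le le_rfl (iSup_le fun i => ?_)
        rw [← pow_succ]
        exact le_iSup (fun n => L ^ n) (i + 1)
    exact hle n hn
  have hxE : x ∈ E 1 := by
    rw [mem_primitives] at hx
    refine Module.End.mem_eigenspace_iff.2 ?_
    simp [Ψ, hx, two_smul]
  obtain ⟨f, hf, hsum⟩ := (Submodule.mem_iSup_iff_exists_finsupp _ _).1 (htop x)
  have hsum' : f 1 + (f.erase 1).sum (fun _ y => y) = x := by
    rw [← hsum]
    by_cases h1 : (1 : ℕ) ∈ f.support
    · exact Finsupp.add_sum_erase f 1 (fun _ y => y) h1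
    · rw [Finsupp.erase_of_notMem_support h1, Finsupp.notMem_support_iff.1 h1, zero_add]
  have hrest : (f.erase 1).sum (fun _ y => y) ∈ ⨆ j, ⨆ (_ : j ≠ 1), E j := by
    refine Submodule.sum_mem _ fun i hi => ?_
    have hi1 : i ≠ 1 := by
      rintro rfl
      simp at hi
    rw [Finsupp.erase_ne hi1]
    exact Submodule.mem_iSup_of_mem i (Submodule.mem_iSup_of_mem hi1 (hLE i (hf i)))
  have hf1 : f 1 ∈ L := by simpa using hf 1
  have hrest' : (f.erase 1).sum (fun _ y => y) ∈ E 1 := by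
    rw [← eq_sub_iff_add_eq'] at hsum'
    rw [hsum']
    exact Submodule.sub_mem _ hxE (hLE 1 (hf 1))
  have h0 := Submodule.disjoint_def.1 (hind 1) _ hrest' hrest
  rw [← hsum', h0, add_zero]
  exact hf1

/-- The symmetric coalgebra `Sym^co(V)` of a finite-dimensional vector space (characteristic
zero): the symmetric algebra with the (unshuffle) comultiplication for which
`Δ v = v ⊗ 1 + 1 ⊗ v`, `v ∈ V`, and `Δ` is multiplicative. -/
def symCo [CharZero k] [Module.Finite k V] : CoCom k where
  carrier := SymmetricAlgebra k V
  pt := 1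
  isConilpotent := isConilpotent_sym k V
  finiteType := Submodule.finiteDimensional_of_le (primitives_sym_le k V)

/-- The projection `Sym^co(V) → V`. -/
def symCo.proj [CharZero k] [Module.Finite k V] : (symCo k V).carrier →ₗ[k] V :=
  symProj k V

end Sym

/-- A coalgebra `S` with a linear map `π : S → V` that vanishes at the base point is cofree on `V`
if every linear map `φ : D → V` from a conilpotent cocommutative coalgebra `D` (with base point `d`,
not necessarily of finite type) that vanishes at the base point lifts uniquely to a coalgebra
morphism `D → S`. -/
structure IsCofree {V : Type u} [AddCommGroup V] [Module k V] (S : CoCom k)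
    (π : S.carrier →ₗ[k] V) : Prop where
  map_pt : π S.pt = 0
  existsUnique_lift : ∀ (D : Type u) [AddCommGroup D] [Module k D] [Coalgebra k D]
    [Coalgebra.IsCocomm k D] (d : D), IsConilpotent k d → ∀ φ : D →ₗ[k] V, φ d = 0 →
      ∃! F : D →ₗc[k] S.carrier, π ∘ₗ (F : D →ₗ[k] S.carrier) = φ

end FormalCoalg

end

/-!
A coalgebra is the union of its finite-dimensional subcoalgebras, and dualizing identifies the
finite-dimensional ones with finite-dimensional local algebras. A square-zero extension of discrete
rings through which a continuous `k`-algebra map out of `𝕜[C]` is to be lifted can be replaced by a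
surjection of such local algebras, so formal submersions are exactly the morphisms with the right
lifting property against injections of finite-dimensional coalgebras. Stability under composition
and base change is then formal.

By Zorn's lemma, a partial section of such a morphism defined on a subcoalgebra extends to a global
section. Sections make formal submersions split, hence effective, epimorphisms that are surjective
on primitives, and they exhibit `g` as a retract of `f ≫ g`. Combined with base change they give the
lifting property against all injections.

Since `Sym` of a finite-dimensional space is cofree, every coalgebra embeds in a cofree one, and
finite limits are cut out of cofree coalgebras as largest subcoalgebras. The same embedding makes a
formal manifold a retract of `Sym (Prim C)`; the retraction is injective on primitives, so it is an
isomorphism. Between cofree coalgebras, lifting problems become linear.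
-/

noncomputable section

namespace FormalCoalg

/-! ### Tensors and linear functionals -/

section Tensor

variable {k X Y : Type*} [Field k] [AddCommGroup X] [Module k X] [AddCommGroup Y] [Module k Y]

theorem apply_rid_lTensor (φ : Module.Dual k X) (ψ : Module.Dual k Y) (t : X ⊗[k] Y) :
    φ (TensorProduct.rid k X (ψ.lTensor X t)) =
      LinearMap.mul' k k (TensorProduct.map φ ψ t) := by
  induction t with
  | zero => simp
  | add s t hs ht => simp only [map_add, hs, ht]
  | tmul x y => simp [mul_comm]

theorem apply_lid_rTensor (φ : Module.Dual k X) (ψ : Module.Dual k Y) (t : X ⊗[k] Y) :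
    ψ (TensorProduct.lid k Y (φ.rTensor Y t)) =
      LinearMap.mul' k k (TensorProduct.map φ ψ t) := by
  induction t with
  | zero => simp
  | add s t hs ht => simp only [map_add, hs, ht]
  | tmul x y => simp

theorem mem_range_rTensor_subtype_of_forall_dual (W : Submodule k X) (t : X ⊗[k] Y)
    (h : ∀ ψ : Module.Dual k Y, TensorProduct.rid k X (ψ.lTensor X t) ∈ W) :
    t ∈ LinearMap.range (W.subtype.rTensor Y) := by
  classical
  let b := Module.Basis.ofVectorSpace k Y
  let c := TensorProduct.equivFinsuppOfBasisRight b t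
  have coeff_eq (j) : c j = TensorProduct.rid k X ((b.coord j).lTensor X t) := by
    have h_eq : Finsupp.lapply j ∘ₗ (TensorProduct.equivFinsuppOfBasisRight b).toLinearMap =
        (TensorProduct.rid k X).toLinearMap ∘ₗ (b.coord j).lTensor X := by
      ext x y
      simp
    exact LinearMap.congr_fun h_eq t
  have expand : t = c.sum fun j x => x ⊗ₜ b j := by
    rw [← TensorProduct.equivFinsuppOfBasisRight_symm_apply, LinearEquiv.symm_apply_apply]
  rw [expand]
  refine Submodule.sum_mem _ fun j _ => ⟨⟨c j, coeff_eq j ▸ h _⟩ ⊗ₜ b j, by simp⟩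

theorem mem_range_map_subtype_of_mem_range {W : Submodule k X} {W' : Submodule k Y}
    {t : X ⊗[k] Y} (h : t ∈ LinearMap.range (W.subtype.rTensor Y))
    (h' : t ∈ LinearMap.range (W'.subtype.lTensor X)) :
    t ∈ LinearMap.range (TensorProduct.map W.subtype W'.subtype) := by
  obtain ⟨p, hp⟩ := W.subtype.exists_leftInverse_of_injective W.ker_subtype
  obtain ⟨p', hp'⟩ := W'.subtype.exists_leftInverse_of_injective W'.ker_subtype
  have left : (W.subtype ∘ₗ p).rTensor Y t = t := by
    obtain ⟨s, rfl⟩ := h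
    rw [← LinearMap.rTensor_comp_apply, LinearMap.comp_assoc, hp, LinearMap.comp_id]
  have right : (W'.subtype ∘ₗ p').lTensor X t = t := by
    obtain ⟨s, rfl⟩ := h'
    rw [← LinearMap.lTensor_comp_apply, LinearMap.comp_assoc, hp', LinearMap.comp_id]
  refine ⟨TensorProduct.map p p' t, ?_⟩
  rw [← LinearMap.comp_apply, ← TensorProduct.map_comp, ← LinearMap.rTensor_comp_lTensor,
    LinearMap.comp_apply, right, left]

theorem tensor_ext_dual {s t : X ⊗[k] Y}
    (h : ∀ (φ : Module.Dual k X) (ψ : Module.Dual k Y),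
      LinearMap.mul' k k (TensorProduct.map φ ψ s) =
        LinearMap.mul' k k (TensorProduct.map φ ψ t)) : s = t := by
  obtain ⟨r, hr⟩ := mem_range_rTensor_subtype_of_forall_dual ⊥ (s - t) fun ψ => by
    rw [Submodule.mem_bot, ← Module.forall_dual_apply_eq_zero_iff k]
    intro φ
    rw [apply_rid_lTensor, map_sub, map_sub, h, sub_self]
  have subtype_bot : (⊥ : Submodule k X).subtype = 0 := LinearMap.ext fun x => x.2
  rwa [subtype_bot, LinearMap.rTensor_zero, LinearMap.zero_apply, eq_comm, sub_eq_zero] at hr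

theorem mem_range_map_dualCoannihilator (M : Submodule k (Module.Dual k X)) (t : X ⊗[k] X)
    (h : ∀ φ ∈ M, ∀ ψ : Module.Dual k X, LinearMap.mul' k k (TensorProduct.map φ ψ t) = 0)
    (h' : ∀ φ ∈ M, ∀ ψ : Module.Dual k X, LinearMap.mul' k k (TensorProduct.map ψ φ t) = 0) :
    t ∈ LinearMap.range
      (TensorProduct.map M.dualCoannihilator.subtype M.dualCoannihilator.subtype) := by
  refine mem_range_map_subtype_of_mem_range ?_ ?_
  · refine mem_range_rTensor_subtype_of_forall_dual _ _ fun ψ => ?_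
    rw [Submodule.mem_dualCoannihilator]
    exact fun φ hφ => (apply_rid_lTensor φ ψ t).trans (h φ hφ ψ)
  · obtain ⟨s, hs⟩ := mem_range_rTensor_subtype_of_forall_dual M.dualCoannihilator
        (TensorProduct.comm k X X t) fun ψ => by
      rw [Submodule.mem_dualCoannihilator]
      intro φ hφ
      rw [apply_rid_lTensor, TensorProduct.map_comm, LinearMap.mul'_comm, h' φ hφ ψ]
    refine ⟨TensorProduct.comm k _ _ s, ?_⟩
    rw [LinearMap.lTensor, TensorProduct.map_comm, ← LinearMap.rTensor, hs,
      TensorProduct.comm_comm]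

theorem mul'_map_eq_zero_of_mem_range {F : Submodule k X} {φ ψ : Module.Dual k X}
    (h : φ ∈ F.dualAnnihilator ∨ ψ ∈ F.dualAnnihilator) {t : X ⊗[k] X}
    (ht : t ∈ LinearMap.range (TensorProduct.map F.subtype F.subtype)) :
    LinearMap.mul' k k (TensorProduct.map φ ψ t) = 0 := by
  obtain ⟨s, rfl⟩ := ht
  rw [← LinearMap.comp_apply (TensorProduct.map _ _), ← TensorProduct.map_comp]
  have comp_subtype {χ : Module.Dual k X} (hχ : χ ∈ F.dualAnnihilator) : χ ∘ₗ F.subtype = 0 :=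
    LinearMap.ext fun x => (Submodule.mem_dualAnnihilator χ).1 hχ x x.2
  rcases h with h | h <;> simp [comp_subtype h]

theorem mem_range_map_comap_subtype {i : X →ₗ[k] Y} (hi : Function.Injective i)
    {F : Submodule k Y} {t : X ⊗[k] X}
    (h : TensorProduct.map i i t ∈ LinearMap.range (TensorProduct.map F.subtype F.subtype)) :
    t ∈ LinearMap.range (TensorProduct.map (F.comap i).subtype (F.comap i).subtype) := by
  have comap_eq : F.comap i = (F.dualAnnihilator.map i.dualMap).dualCoannihilator := by
    ext x
    rw [Submodule.mem_comap, ← Subspace.forall_mem_dualAnnihilator_apply_eq_zero_iff,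
      Submodule.mem_dualCoannihilator]
    simp only [Submodule.mem_map, forall_exists_index, and_imp, forall_apply_eq_imp_iff₂,
      LinearMap.dualMap_apply]
  have extend (ψ : Module.Dual k X) : ∃ ψ' : Module.Dual k Y, ψ' ∘ₗ i = ψ :=
    LinearMap.dualMap_surjective_of_injective hi ψ
  rw [comap_eq]
  apply mem_range_map_dualCoannihilator
  all_goals
    rintro _ ⟨φ, hφ, rfl⟩ ψ
    obtain ⟨ψ, rfl⟩ := extend ψ
    rw [LinearMap.dualMap_apply', TensorProduct.map_comp, LinearMap.comp_apply]
  · exact mul'_map_eq_zero_of_mem_range (Or.inl hφ) h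
  · exact mul'_map_eq_zero_of_mem_range (Or.inr hφ) h

theorem exists_linearMap_lift {V W : Type*} [AddCommGroup V] [Module k V] [AddCommGroup W]
    [Module k W] {i : X →ₗ[k] Y} (hi : Function.Injective i) {π : V →ₗ[k] W}
    (hπ : Function.Surjective π) (a : X →ₗ[k] V) (b : Y →ₗ[k] W) (h : π ∘ₗ a = b ∘ₗ i) :
    ∃ ℓ : Y →ₗ[k] V, ℓ ∘ₗ i = a ∧ π ∘ₗ ℓ = b := by
  obtain ⟨r, hr⟩ := i.exists_leftInverse_of_injective (LinearMap.ker_eq_bot.2 hi)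
  obtain ⟨s, hs⟩ := π.exists_rightInverse_of_surjective (LinearMap.range_eq_top.2 hπ)
  refine ⟨a ∘ₗ r + s ∘ₗ (b - b ∘ₗ i ∘ₗ r), ?_, ?_⟩
  · rw [LinearMap.add_comp, LinearMap.comp_assoc, hr, LinearMap.comp_assoc, LinearMap.sub_comp]
    simp only [LinearMap.comp_assoc, hr, LinearMap.comp_id, sub_self, LinearMap.comp_zero, add_zero]
  · rw [LinearMap.comp_add, ← LinearMap.comp_assoc, ← LinearMap.comp_assoc, hs, h,
      LinearMap.id_comp, LinearMap.comp_assoc, add_sub_cancel]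

end Tensor

/-! ### Subcoalgebras and the primitive filtration -/

section Conilpotent

variable {k C D : Type u} [Field k]
  [AddCommGroup C] [Module k C] [Coalgebra k C] [AddCommGroup D] [Module k D] [Coalgebra k D]

theorem comul_eq_reducedComul_add (e x : C) :
    Coalgebra.comul (R := k) x = reducedComul k e x + x ⊗ₜ[k] e + e ⊗ₜ[k] x := by
  rw [reducedComul_apply]; abel

theorem reducedComul_self {e : C} (he : IsGroupLikeElem k e) :
    reducedComul k e e = -(e ⊗ₜ[k] e) := by
  rw [reducedComul_apply, he.comul_eq_tmul_self]; abel

theorem map_reducedComul (f : C →ₗc[k] D) (e x : C) :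
    TensorProduct.map (f : C →ₗ[k] D) (f : C →ₗ[k] D) (reducedComul k e x) =
      reducedComul k (f e) (f x) := by
  have h := CoalgHomClass.map_comp_comul_apply f x
  rw [reducedComul_apply, reducedComul_apply, ← h]
  simp

theorem counit_eq_zero_of_mem_primitives {e x : C} (he : IsGroupLikeElem k e)
    (hx : x ∈ primitives k e) : Coalgebra.counit (R := k) x = 0 := by
  have counit_comul : LinearMap.mul' k k (TensorProduct.map (Coalgebra.counit (R := k))
      (Coalgebra.counit (R := k)) (Coalgebra.comul (R := k) x)) = Coalgebra.counit (R := k) x :=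
    congrArg (fun φ : WithConv (C →ₗ[k] k) => φ x) (one_mul 1)
  rw [mem_primitives.1 hx] at counit_comul
  simpa [he.counit_eq_one] using counit_comul

/-- A subspace `W` of a coalgebra with `Δ W ⊆ W ⊗ W`. -/
def IsSubcoalgebra (k : Type u) [Field k] [Module k C] [Coalgebra k C] (W : Submodule k C) :
    Prop :=
  W ≤ (LinearMap.range (TensorProduct.map W.subtype W.subtype)).comap Coalgebra.comul

theorem isSubcoalgebra_sSup {S : Set (Submodule k C)} (h : ∀ W ∈ S, IsSubcoalgebra k W) :
    IsSubcoalgebra k (sSup S) :=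
  sSup_le fun W hW _ hx => TensorProduct.range_mapIncl_mono (le_sSup hW) (le_sSup hW) (h W hW hx)

theorem IsSubcoalgebra.sup {W W' : Submodule k C} (h : IsSubcoalgebra k W)
    (h' : IsSubcoalgebra k W') : IsSubcoalgebra k (W ⊔ W') := by
  rw [← sSup_pair]
  exact isSubcoalgebra_sSup (by rintro _ (rfl | rfl) <;> assumption)

theorem IsSubcoalgebra.map (f : C →ₗc[k] D) {W : Submodule k C} (hW : IsSubcoalgebra k W) :
    IsSubcoalgebra k (W.map (f : C →ₗ[k] D)) := by
  rintro _ ⟨x, hx, rfl⟩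
  obtain ⟨t, ht⟩ := hW hx
  rw [Submodule.mem_comap]
  have h : TensorProduct.map (f : C →ₗ[k] D) (f : C →ₗ[k] D) (Coalgebra.comul (R := k) x) =
    Coalgebra.comul (R := k) ((f : C →ₗ[k] D) x) := CoalgHomClass.map_comp_comul_apply f x
  let f' := (f : C →ₗ[k] D).restrict fun x (hx : x ∈ W) => Submodule.mem_map_of_mem hx
  refine ⟨TensorProduct.map f' f' t, ?_⟩
  rw [← h, ← ht, ← LinearMap.comp_apply, ← LinearMap.comp_apply, ← TensorProduct.map_comp,
    ← TensorProduct.map_comp]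
  rfl

theorem IsSubcoalgebra.comap {f : C →ₗc[k] D} (hf : Function.Injective f) {W : Submodule k D}
    (hW : IsSubcoalgebra k W) : IsSubcoalgebra k (W.comap (f : C →ₗ[k] D)) := fun x hx =>
  mem_range_map_comap_subtype hf
    ((CoalgHomClass.map_comp_comul_apply f x).symm ▸ hW (Submodule.mem_comap.1 hx))

theorem isSubcoalgebra_top : IsSubcoalgebra k (⊤ : Submodule k C) := fun x _ => by
  have hsurj : Function.Surjective (⊤ : Submodule k C).subtype := fun y => ⟨⟨y, trivial⟩, rfl⟩
  exact TensorProduct.map_surjective hsurj hsurj _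

theorem isSubcoalgebra_range (f : C →ₗc[k] D) :
    IsSubcoalgebra k (LinearMap.range (f : C →ₗ[k] D)) := by
  rw [LinearMap.range_eq_map]
  exact isSubcoalgebra_top.map f

theorem primFiltration_mono {e : C} (he : IsGroupLikeElem k e) : Monotone (primFiltration k e) := by
  refine monotone_nat_of_le_succ fun n => ?_
  induction n with
  | zero =>
    rw [primFiltration, Submodule.span_singleton_le_iff_mem, primFiltration,
      Submodule.mem_comap, reducedComul_self he]
    have he₀ := Submodule.mem_span_singleton_self (R := k) e
    exact Submodule.neg_mem _ (tmul_mem_range_map k _ he₀ he₀)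
  | succ n ih => exact fun x hx => TensorProduct.range_mapIncl_mono ih ih hx

theorem self_mem_primFiltration {e : C} (he : IsGroupLikeElem k e) (n : ℕ) :
    e ∈ primFiltration k e n :=
  primFiltration_mono he n.zero_le (Submodule.mem_span_singleton_self e)

theorem isSubcoalgebra_primFiltration {e : C} (he : IsGroupLikeElem k e) (n : ℕ) :
    IsSubcoalgebra k (primFiltration k e n) := by
  intro x hx
  have he' := self_mem_primFiltration he n
  have hred : reducedComul k e x ∈ LinearMap.range
      (TensorProduct.map (primFiltration k e n).subtype (primFiltration k e n).subtype) :=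
    have hn := primFiltration_mono he n.le_succ
    hn hx
  rw [Submodule.mem_comap, comul_eq_reducedComul_add e]
  exact Submodule.add_mem _ (Submodule.add_mem _ hred (tmul_mem_range_map k _ hx he'))
    (tmul_mem_range_map k _ he' hx)

theorem isSubcoalgebra_span_singleton {e : C} (he : IsGroupLikeElem k e) :
    IsSubcoalgebra k (Submodule.span k {e}) :=
  isSubcoalgebra_primFiltration he 0

theorem finite_primFiltration {e : C} [Module.Finite k (primitives k e)] (n : ℕ) :
    Module.Finite k (primFiltration k e n) := by
  induction n with
  | zero => exact inferInstanceAs (Module.Finite k (Submodule.span k {e}))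
  | succ n ih =>
    rw [Module.Finite.iff_fg]
    refine Submodule.fg_of_fg_map_of_fg_inf_ker (reducedComul k e) ?_ ?_
    · rw [← Module.Finite.iff_fg]
      exact Submodule.finiteDimensional_of_le
        (S₂ := LinearMap.range (TensorProduct.map (primFiltration k e n).subtype
          (primFiltration k e n).subtype)) (Submodule.map_le_iff_le_comap.2 le_rfl)
    · rw [← Module.Finite.iff_fg]
      exact Submodule.finiteDimensional_of_le (S₂ := primitives k e) inf_le_right

/-- If `f x = 0` with `x` in a step of the filtration, then the reduced comultiplication of `x` is
killed by `f ⊗ f`, which is injective on the previous step by induction; so `x` is primitive. -/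
theorem IsConilpotent.injective {e : C} (he : IsConilpotent k e) (f : C →ₗc[k] D)
    (hf : ∀ x ∈ primitives k e, f x = 0 → x = 0) : Function.Injective f := by
  have map_pt_ne_zero : f e ≠ 0 := fun h => by
    have := CoalgHomClass.counit_comp_apply f e
    rw [h, map_zero, he.isGroupLike.counit_eq_one] at this
    exact zero_ne_one this
  have injOn_primFiltration (n) : ∀ x ∈ primFiltration k e n, f x = 0 → x = 0 := by
    induction n with
    | zero =>
      intro x hx h
      obtain ⟨c, rfl⟩ := Submodule.mem_span_singleton.1 hx
      rw [map_smul, smul_eq_zero_iff_left map_pt_ne_zero] at h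
      rw [h, zero_smul]
    | succ n ih =>
      intro x hx h
      refine hf x ?_ h
      obtain ⟨t, ht⟩ := hx
      have hinj : Function.Injective ((f : C →ₗ[k] D) ∘ₗ (primFiltration k e n).subtype) :=
        (injective_iff_map_eq_zero _).2 fun y hy => Subtype.ext (ih y y.2 hy)
      have map_eq_zero := map_reducedComul f e x
      rw [h, map_zero, ← ht, ← LinearMap.comp_apply, ← TensorProduct.map_comp] at map_eq_zero
      rw [primitives, LinearMap.mem_ker, ← ht, (map_eq_zero_iff _
        (TensorProduct.map_injective_of_flat_flat _ _ hinj hinj)).1 map_eq_zero, map_zero]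
  rw [injective_iff_map_eq_zero]
  intro x
  obtain ⟨n, hn⟩ := he.exhaustive x
  exact injOn_primFiltration n x hn

theorem IsConilpotent.eq_counit_smul {e : C} (he : IsConilpotent k e) (h : primitives k e = ⊥)
    (x : C) : x = Coalgebra.counit (R := k) x • e := by
  have counit_injective : Function.Injective (Coalgebra.counitCoalgHom k C) :=
    he.injective _ fun y hy _ => (Submodule.mem_bot k).1 (h ▸ hy)
  apply counit_injective
  rw [map_smul, Coalgebra.counitCoalgHom_apply, Coalgebra.counitCoalgHom_apply,
    he.isGroupLike.counit_eq_one, smul_eq_mul, mul_one]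

theorem comap_primFiltration_le {e : C} (f : C →ₗc[k] D) (hf : Function.Injective f) (n : ℕ) :
    (primFiltration k (f e) n).comap (f : C →ₗ[k] D) ≤ primFiltration k e n := by
  induction n with
  | zero =>
    intro x hx
    obtain ⟨c, hc⟩ := Submodule.mem_span_singleton.1 hx
    exact Submodule.mem_span_singleton.2 ⟨c, hf (by rw [map_smul, hc]; rfl)⟩
  | succ n ih =>
    intro x hx
    have hx' : TensorProduct.map (f : C →ₗ[k] D) (f : C →ₗ[k] D) (reducedComul k e x) ∈
        LinearMap.range (TensorProduct.map
          (primFiltration k (f e) n).subtype (primFiltration k (f e) n).subtype) := by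
      rw [map_reducedComul]
      exact hx
    exact TensorProduct.range_mapIncl_mono ih ih (mem_range_map_comap_subtype hf hx')

theorem IsConilpotent.of_injective {e : C} {e' : D} (he : IsGroupLikeElem k e)
    (he' : IsConilpotent k e') (f : C →ₗc[k] D) (hf : Function.Injective f) :
    IsConilpotent k e := by
  obtain rfl : f e = e' := he'.eq_of_isGroupLike (he.map f)
  refine ⟨he, fun x => ?_⟩
  obtain ⟨n, hn⟩ := he'.exhaustive (f x)
  exact ⟨n, comap_primFiltration_le f hf n hn⟩

theorem map_mem_primitives (f : C →ₗc[k] D) {e x : C} (hx : x ∈ primitives k e) :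
    f x ∈ primitives k (f e) := by
  rw [primitives, LinearMap.mem_ker] at hx ⊢
  rw [← map_reducedComul, hx, map_zero]

theorem finite_primitives_of_injective {e : C} (f : C →ₗc[k] D) (hf : Function.Injective f)
    [Module.Finite k (primitives k (f e))] : Module.Finite k (primitives k e) :=
  Module.Finite.of_injective ((f : C →ₗ[k] D).restrict (p := primitives k e)
    (q := primitives k (f e)) fun _ hx => map_mem_primitives f hx)
    fun _ _ h => Subtype.ext (hf (congrArg Subtype.val h))

end Conilpotent

/-! ### The coalgebra structure of a subcoalgebra -/

section Sub

variable {k C W : Type u} [Field k] [AddCommGroup C] [Module k C] [Coalgebra k C]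
  [AddCommGroup W] [Module k W]

/-- The coalgebra structure for which an injective linear map `ι` is a coalgebra morphism, given a
lift `δ` of the comultiplication. -/
@[reducible] def coalgebraOfInjective (ι : W →ₗ[k] C) (hι : Function.Injective ι)
    (δ : W →ₗ[k] W ⊗[k] W) (hδ : TensorProduct.map ι ι ∘ₗ δ = Coalgebra.comul ∘ₗ ι) :
    Coalgebra k W where
  comul := δ
  counit := Coalgebra.counit ∘ₗ ι
  coassoc := by
    have hinj := TensorProduct.map_injective_of_flat_flat ι _ hι
      (TensorProduct.map_injective_of_flat_flat ι ι hι hι)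
    ext w
    apply hinj
    have hδw := LinearMap.congr_fun hδ w
    simp only [LinearMap.comp_apply, LinearEquiv.coe_coe] at hδw ⊢
    rw [TensorProduct.map_map_assoc, ← LinearMap.comp_apply,
      ← LinearMap.comp_apply (TensorProduct.map _ (TensorProduct.map _ _)),
      LinearMap.map_comp_rTensor, LinearMap.map_comp_lTensor, hδ, ← LinearMap.rTensor_comp_map,
      ← LinearMap.lTensor_comp_map, LinearMap.comp_apply, LinearMap.comp_apply, hδw,
      Coalgebra.coassoc_apply]
  rTensor_counit_comp_comul := by
    ext w
    apply TensorProduct.map_injective_of_flat_flat LinearMap.id ι Function.injective_id hι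
    have hδw := LinearMap.congr_fun hδ w
    simp only [LinearMap.comp_apply] at hδw ⊢
    rw [← LinearMap.comp_apply, LinearMap.map_comp_rTensor, LinearMap.id_comp,
      ← LinearMap.rTensor_comp_map, LinearMap.comp_apply, hδw, Coalgebra.rTensor_counit_comul]
    simp
  lTensor_counit_comp_comul := by
    ext w
    apply TensorProduct.map_injective_of_flat_flat ι LinearMap.id hι Function.injective_id
    have hδw := LinearMap.congr_fun hδ w
    simp only [LinearMap.comp_apply] at hδw ⊢
    rw [← LinearMap.comp_apply, LinearMap.map_comp_lTensor, LinearMap.id_comp,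
      ← LinearMap.lTensor_comp_map, LinearMap.comp_apply, hδw, Coalgebra.lTensor_counit_comul]
    simp

variable {W : Submodule k C}

theorem IsSubcoalgebra.exists_comul (hW : IsSubcoalgebra k W) :
    ∃ δ : W →ₗ[k] W ⊗[k] W,
      TensorProduct.map W.subtype W.subtype ∘ₗ δ = Coalgebra.comul ∘ₗ W.subtype := by
  obtain ⟨p, hp⟩ := W.subtype.exists_leftInverse_of_injective W.ker_subtype
  refine ⟨TensorProduct.map p p ∘ₗ Coalgebra.comul ∘ₗ W.subtype, LinearMap.ext fun w => ?_⟩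
  obtain ⟨t, ht⟩ := hW w.2
  rw [LinearMap.comp_apply, LinearMap.comp_apply, LinearMap.comp_apply, Submodule.subtype_apply,
    ← ht, ← LinearMap.comp_apply (TensorProduct.map p p), ← TensorProduct.map_comp, hp,
    TensorProduct.map_id, LinearMap.id_apply]

/-- The coalgebra structure of a subcoalgebra. -/
@[reducible] def IsSubcoalgebra.coalgebra (hW : IsSubcoalgebra k W) : Coalgebra k W :=
  coalgebraOfInjective W.subtype W.subtype_injective hW.exists_comul.choose
    hW.exists_comul.choose_spec

/-- The inclusion of a subcoalgebra as a coalgebra morphism. -/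
def IsSubcoalgebra.subtype (hW : IsSubcoalgebra k W) :
    letI := hW.coalgebra
    W →ₗc[k] C :=
  letI := hW.coalgebra
  { W.subtype with
    counit_comp := rfl
    map_comp_comul := hW.exists_comul.choose_spec }

end Sub

section Injective

variable {k C D T : Type u} [Field k] [AddCommGroup C] [Module k C] [Coalgebra k C]
  [AddCommGroup D] [Module k D] [Coalgebra k D] [AddCommGroup T] [Module k T] [Coalgebra k T]

theorem map_injective_of_coalgHom_injective {f : C →ₗc[k] D} (hf : Function.Injective f) :
    Function.Injective (TensorProduct.map (f : C →ₗ[k] D) (f : C →ₗ[k] D)) :=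
  TensorProduct.map_injective_of_flat_flat _ _ hf hf

theorem isCocomm_of_injective [Coalgebra.IsCocomm k D] (f : C →ₗc[k] D)
    (hf : Function.Injective f) : Coalgebra.IsCocomm k C where
  comm_comp_comul := LinearMap.ext fun x => by
    apply map_injective_of_coalgHom_injective hf
    rw [LinearMap.comp_apply, LinearEquiv.coe_coe, TensorProduct.map_comm]
    have h := CoalgHomClass.map_comp_comul_apply f x
    exact (congrArg _ h).trans ((Coalgebra.comm_comul k (f x)).trans h.symm)

theorem isGroupLikeElem_of_injective (f : C →ₗc[k] D) (hf : Function.Injective f) {e : C}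
    (he : IsGroupLikeElem k (f e)) : IsGroupLikeElem k e where
  counit_eq_one := (CoalgHomClass.counit_comp_apply f e).symm.trans he.counit_eq_one
  comul_eq_tmul_self := by
    apply map_injective_of_coalgHom_injective hf
    exact (CoalgHomClass.map_comp_comul_apply f e).trans he.comul_eq_tmul_self

theorem exists_coalgHom_comp_eq {i : C →ₗc[k] D} (hi : Function.Injective i) (g : T →ₗc[k] D)
    (h : LinearMap.range (g : T →ₗ[k] D) ≤ LinearMap.range (i : C →ₗ[k] D)) :
    ∃ g' : T →ₗc[k] C, i.comp g' = g := by
  let g' : T →ₗ[k] C := (LinearEquiv.ofInjective (i : C →ₗ[k] D) hi).symm.toLinearMap ∘ₗ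
    (g : T →ₗ[k] D).codRestrict _ fun x => h ⟨x, rfl⟩
  have comp_eq : (i : C →ₗ[k] D) ∘ₗ g' = (g : T →ₗ[k] D) := LinearMap.ext fun x =>
    congrArg Subtype.val ((LinearEquiv.ofInjective (i : C →ₗ[k] D) hi).apply_symm_apply
      ⟨g x, h ⟨x, rfl⟩⟩)
  have apply_eq (x) : i (g' x) = g x := LinearMap.congr_fun comp_eq x
  refine ⟨{ g' with counit_comp := ?_, map_comp_comul := ?_ }, DFunLike.ext _ _ apply_eq⟩
  · ext x
    change Coalgebra.counit (R := k) (g' x) = _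
    rw [← CoalgHomClass.counit_comp_apply i, apply_eq, CoalgHomClass.counit_comp_apply]
  · ext x
    apply map_injective_of_coalgHom_injective hi
    change TensorProduct.map _ _ (TensorProduct.map g' g' (Coalgebra.comul (R := k) x)) =
      TensorProduct.map _ _ (Coalgebra.comul (R := k) (g' x))
    rw [← LinearMap.comp_apply, ← TensorProduct.map_comp, comp_eq]
    refine (CoalgHomClass.map_comp_comul_apply g x).trans ?_
    rw [← apply_eq]
    exact (CoalgHomClass.map_comp_comul_apply i (g' x)).symm

end Injective

/-! ### Injective morphisms and subobjects -/

namespace CoCom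

variable {k : Type u} [Field k] {C D T : CoCom k}

theorem hom_ext {f g : C ⟶ D} (h : ∀ x, f.hom x = g.hom x) : f = g :=
  CoCom.Hom.ext (DFunLike.ext _ _ h)

/-- A coalgebra with an injective coalgebra morphism to an object, as an object. -/
def ofInjective (C : CoCom k) {W : Type u} [AddCommGroup W] [Module k W] [Coalgebra k W]
    (ι : W →ₗc[k] C.carrier) (hι : Function.Injective ι) (e : W) (he : ι e = C.pt) : CoCom k where
  carrier := W
  isCocomm := isCocomm_of_injective ι hι
  pt := e
  isConilpotent := C.isConilpotent.of_injective
    (isGroupLikeElem_of_injective ι hι (he ▸ C.isConilpotent.isGroupLike)) ι hι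
  finiteType := by
    have : Module.Finite k (primitives k (ι e)) := he ▸ C.finiteType
    exact finite_primitives_of_injective ι hι

section sub

variable (W : Submodule k C.carrier) (hW : IsSubcoalgebra k W) (hpt : C.pt ∈ W)

/-- A subcoalgebra that contains the base point, as an object. -/
def sub : CoCom k :=
  letI := hW.coalgebra
  C.ofInjective hW.subtype W.subtype_injective ⟨C.pt, hpt⟩ rfl

/-- The inclusion of a subcoalgebra as a morphism. -/
def subι : C.sub W hW hpt ⟶ C :=
  CoCom.Hom.mk (C := C.sub W hW hpt) hW.subtype

theorem subι_injective : Function.Injective (C.subι W hW hpt).hom :=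
  W.subtype_injective

theorem range_subι :
    LinearMap.range ((C.subι W hW hpt).hom : (C.sub W hW hpt).carrier →ₗ[k] C.carrier) = W :=
  W.range_subtype

theorem subι_mem (x : (C.sub W hW hpt).carrier) : (C.subι W hW hpt).hom x ∈ W := x.2

end sub

theorem exists_comp_eq_of_injective {i : C ⟶ D} (hi : Function.Injective i.hom) (g : T ⟶ D)
    (h : LinearMap.range (g.hom : T.carrier →ₗ[k] D.carrier) ≤
      LinearMap.range (i.hom : C.carrier →ₗ[k] D.carrier)) : ∃ g' : T ⟶ C, g' ≫ i = g := by
  obtain ⟨g', hg'⟩ := exists_coalgHom_comp_eq hi g.hom h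
  exact ⟨⟨g'⟩, CoCom.Hom.ext hg'⟩

theorem isIso_of_bijective {f : C ⟶ D} (hf : Function.Bijective f.hom) : IsIso f := by
  obtain ⟨g, hg⟩ := exists_comp_eq_of_injective hf.1 (𝟙 D) fun y _ => hf.2 y
  refine ⟨g, hom_ext fun x => hf.1 ?_, hg⟩
  exact congrArg (fun m : D ⟶ D => m.hom (f.hom x)) hg

theorem injective_of_prim_map_injective {f : C ⟶ D} (h : Function.Injective (Prim.map f)) :
    Function.Injective f.hom :=
  C.isConilpotent.injective f.hom fun x hx hfx => by
    have map_eq_zero : Prim.map f ⟨x, hx⟩ = 0 := Subtype.ext hfx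
    exact congrArg Subtype.val ((map_eq_zero_iff _ h).1 map_eq_zero)

/-- The largest subcoalgebra contained in a subspace; it cuts out the limits of coalgebras. -/
def largestSubcoalgebra (E : Submodule k C.carrier) : Submodule k C.carrier :=
  sSup {W | IsSubcoalgebra k W ∧ W ≤ E}

theorem isSubcoalgebra_largestSubcoalgebra (E : Submodule k C.carrier) :
    IsSubcoalgebra k (largestSubcoalgebra E) :=
  isSubcoalgebra_sSup fun _ hW => hW.1

theorem largestSubcoalgebra_le (E : Submodule k C.carrier) : largestSubcoalgebra E ≤ E :=
  sSup_le fun _ hW => hW.2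

theorem pt_mem_largestSubcoalgebra {E : Submodule k C.carrier} (h : C.pt ∈ E) :
    C.pt ∈ largestSubcoalgebra E := by
  have hle : Submodule.span k {C.pt} ≤ largestSubcoalgebra E :=
    le_sSup ⟨isSubcoalgebra_span_singleton C.isConilpotent.isGroupLike,
      (Submodule.span_singleton_le_iff_mem _ _).2 h⟩
  exact hle (Submodule.mem_span_singleton_self _)

theorem range_le_largestSubcoalgebra {E : Submodule k C.carrier} (g : T ⟶ C)
    (h : ∀ x, g.hom x ∈ E) :
    LinearMap.range (g.hom : T.carrier →ₗ[k] C.carrier) ≤ largestSubcoalgebra E :=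
  le_sSup ⟨isSubcoalgebra_range g.hom, by rintro _ ⟨x, rfl⟩; exact h x⟩

end CoCom

/-! ### Exponentials in convolution algebras -/

section ConvolutionExponential

open Polynomial

variable {k D A B : Type u} [Field k] [AddCommGroup D] [Module k D] [Coalgebra k D]
  [CommRing A] [Algebra k A] [CommRing B] [Algebra k B]

theorem convMul_apply_of_isGroupLikeElem {e : D} (he : IsGroupLikeElem k e)
    (a b : WithConv (D →ₗ[k] A)) : (a * b) e = a e * b e := by
  rw [LinearMap.convMul_apply, he.comul_eq_tmul_self, TensorProduct.map_tmul,
    LinearMap.mul'_apply]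

theorem convMul_apply_eq_zero {e : D} (he : IsGroupLikeElem k e) {n : ℕ}
    {a b : WithConv (D →ₗ[k] A)} (ha : ∀ x ∈ primFiltration k e n, a x = 0)
    (hb : ∀ x ∈ primFiltration k e n, b x = 0) :
    ∀ x ∈ primFiltration k e (n + 1), (a * b) x = 0 := by
  intro x hx
  have reduced_mem_ker : reducedComul k e x ∈ LinearMap.ker (LinearMap.mul' k A ∘ₗ
      TensorProduct.map a.ofConv b.ofConv) := by
    refine range_map_le k _ _ (fun y hy z _ => ?_) hx
    rw [LinearMap.mem_ker, LinearMap.comp_apply, TensorProduct.map_tmul, ha y hy,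
      TensorProduct.zero_tmul, map_zero]
  have he' := self_mem_primFiltration he n
  rw [LinearMap.convMul_apply, comul_eq_reducedComul_add e, map_add, map_add, map_add, map_add,
    ← LinearMap.comp_apply, LinearMap.mem_ker.1 reduced_mem_ker, TensorProduct.map_tmul,
    TensorProduct.map_tmul, ha e he', hb e he']
  simp

theorem convPow_apply_eq_zero {e : D} (he : IsGroupLikeElem k e) {φ : WithConv (D →ₗ[k] A)}
    (hφ : φ e = 0) (n : ℕ) : ∀ m, 2 ^ n ≤ m → ∀ x ∈ primFiltration k e n, (φ ^ m) x = 0 := by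
  induction n with
  | zero =>
    intro m hm x hx
    obtain ⟨c, rfl⟩ := Submodule.mem_span_singleton.1 hx
    obtain ⟨m, rfl⟩ := Nat.exists_eq_add_of_le hm
    rw [map_smul, pow_zero, pow_add, pow_one, convMul_apply_of_isGroupLikeElem he, hφ, zero_mul,
      smul_zero]
  | succ n ih =>
    intro m hm
    obtain ⟨m, rfl⟩ := Nat.exists_eq_add_of_le hm
    rw [pow_succ, mul_two, add_assoc, pow_add]
    exact convMul_apply_eq_zero he (ih _ le_rfl) (ih _ (Nat.le_add_right _ _))

variable (D) in
/-- Composition with an algebra morphism, as a morphism of convolution algebras. -/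
def convPostcomp (g : A →ₐ[k] B) : WithConv (D →ₗ[k] A) →+* WithConv (D →ₗ[k] B) where
  toFun φ := WithConv.toConv (g.toLinearMap ∘ₗ φ.ofConv)
  map_one' := by
    ext x
    simp [LinearMap.convOne_def]
  map_mul' φ ψ := congrArg WithConv.toConv (LinearMap.algHom_comp_convMul_distrib g φ ψ)
  map_zero' := by ext x; simp
  map_add' φ ψ := by ext x; simp

theorem convPostcomp_apply (g : A →ₐ[k] B) (φ : WithConv (D →ₗ[k] A)) (x : D) :
    convPostcomp D g φ x = g (φ x) := rfl

/-- The functions `φ` on a coalgebra for which the convolution exponential `∑ φⁿ / n!` is a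
pointwise finite sum. -/
def IsLocallyNilpotent (φ : WithConv (D →ₗ[k] A)) : Prop :=
  ∀ x, ∃ N, ∀ n, N ≤ n → (φ ^ n) x = 0

theorem IsConilpotent.isLocallyNilpotent {e : D} (he : IsConilpotent k e)
    {φ : WithConv (D →ₗ[k] A)} (hφ : φ e = 0) : IsLocallyNilpotent φ := fun x => by
  obtain ⟨n, hn⟩ := he.exhaustive x
  exact ⟨2 ^ n, fun m hm => convPow_apply_eq_zero he.isGroupLike hφ n m hm x hn⟩

theorem IsLocallyNilpotent.convPostcomp {φ : WithConv (D →ₗ[k] A)} (hφ : IsLocallyNilpotent φ)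
    (g : A →ₐ[k] B) : IsLocallyNilpotent (convPostcomp D g φ) := fun x => by
  obtain ⟨N, hN⟩ := hφ x
  refine ⟨N, fun n hn => ?_⟩
  rw [← map_pow, convPostcomp_apply, hN n hn, map_zero]

theorem IsLocallyNilpotent.exists_coeff_eq {φ : WithConv (D →ₗ[k] A)}
    (hφ : IsLocallyNilpotent φ) :
    ∃ P : D →ₗ[k] A[X], ∀ x n, (P x).coeff n = ((n.factorial : k)⁻¹ • φ ^ n) x := by
  choose N hN using hφ
  let P (x : D) : A[X] :=
    ∑ i ∈ Finset.range (N x), monomial i (((i.factorial : k)⁻¹ • φ ^ i) x)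
  have coeff_eq (x n) : (P x).coeff n = ((n.factorial : k)⁻¹ • φ ^ n) x := by
    simp only [P, finsetSum_coeff, coeff_monomial, Finset.sum_ite_eq', Finset.mem_range]
    split_ifs with hn
    · rfl
    · exact ((congrArg _ (hN x n (not_lt.1 hn))).trans (smul_zero _)).symm
  refine ⟨{ toFun := P, map_add' := fun x y => ?_, map_smul' := fun c x => ?_ }, coeff_eq⟩
  · ext n
    rw [coeff_add, coeff_eq, coeff_eq, coeff_eq, map_add]
  · ext n
    rw [coeff_smul, coeff_eq, coeff_eq, map_smul, RingHom.id_apply]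

/-- The exponential `∑ φⁿ / n! Tⁿ` of `T φ` for the convolution product. The polynomial variable
`T` makes the infinite sums of the proof of the functional equation into identities between
coefficients. -/
def polyConvExp {φ : WithConv (D →ₗ[k] A)} (hφ : IsLocallyNilpotent φ) :
    WithConv (D →ₗ[k] A[X]) :=
  WithConv.toConv hφ.exists_coeff_eq.choose

theorem coeff_polyConvExp {φ : WithConv (D →ₗ[k] A)} (hφ : IsLocallyNilpotent φ) (x : D) (n : ℕ) :
    (polyConvExp hφ x).coeff n = ((n.factorial : k)⁻¹ • φ ^ n) x :=
  hφ.exists_coeff_eq.choose_spec x n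

variable (k A) in
/-- Evaluation of polynomials at `1`. -/
def evalOne : A[X] →ₐ[k] A := (aeval (R := A) (1 : A)).restrictScalars k

/-- The exponential `∑ φⁿ / n!` for the convolution product. -/
def convExp {φ : WithConv (D →ₗ[k] A)} (hφ : IsLocallyNilpotent φ) : WithConv (D →ₗ[k] A) :=
  convPostcomp D (evalOne k A) (polyConvExp hφ)

theorem coeff_convMul_apply (F G : WithConv (D →ₗ[k] A[X])) (x : D) (n : ℕ) :
    ((F * G) x).coeff n = ∑ p ∈ Finset.HasAntidiagonal.antidiagonal n,
      (WithConv.toConv ((lcoeff A p.1).restrictScalars k ∘ₗ F.ofConv) *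
        WithConv.toConv ((lcoeff A p.2).restrictScalars k ∘ₗ G.ofConv)) x := by
  simp only [(Coalgebra.Repr.arbitrary k x).convMul_apply, finsetSum_coeff, coeff_mul]
  rw [Finset.sum_comm]
  rfl

theorem inv_factorial_smul_add_pow {R : Type*} [CommRing R] [Algebra k R] [CharZero k] (a b : R)
    (n : ℕ) : (n.factorial : k)⁻¹ • (a + b) ^ n = ∑ p ∈ Finset.HasAntidiagonal.antidiagonal n,
      ((p.1.factorial : k)⁻¹ • a ^ p.1) * ((p.2.factorial : k)⁻¹ • b ^ p.2) := by
  rw [(Commute.all a b).add_pow', Finset.smul_sum]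
  refine Finset.sum_congr rfl fun p hp => ?_
  have hn : (n.factorial : k) ≠ 0 := Nat.cast_ne_zero.2 n.factorial_ne_zero
  have sum_eq : p.1 + p.2 = n := Finset.HasAntidiagonal.mem_antidiagonal.1 hp
  rw [← Nat.cast_smul_eq_nsmul k, smul_smul, smul_mul_smul_comm, ← sum_eq, Nat.cast_add_choose,
    sum_eq, mul_div, inv_mul_cancel₀ hn, one_div,
    mul_inv]

theorem convExp_add [CharZero k] [Coalgebra.IsCocomm k D] {φ ψ : WithConv (D →ₗ[k] A)}
    (hφ : IsLocallyNilpotent φ) (hψ : IsLocallyNilpotent ψ) (h : IsLocallyNilpotent (φ + ψ)) :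
    convExp h = convExp hφ * convExp hψ := by
  have lcoeff_comp {χ : WithConv (D →ₗ[k] A)} (hχ : IsLocallyNilpotent χ) (n : ℕ) :
      WithConv.toConv ((lcoeff A n).restrictScalars k ∘ₗ (polyConvExp hχ).ofConv) =
        (n.factorial : k)⁻¹ • χ ^ n :=
    WithConv.ext (LinearMap.ext fun x => coeff_polyConvExp hχ x n)
  have polyConvExp_add : polyConvExp h = polyConvExp hφ * polyConvExp hψ := by
    ext x n
    refine (coeff_polyConvExp h x n).trans (Eq.trans ?_ (coeff_convMul_apply _ _ x n).symm)
    simp only [lcoeff_comp]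
    rw [inv_factorial_smul_add_pow, WithConv.ofConv_sum, LinearMap.sum_apply]
  rw [convExp, polyConvExp_add, map_mul]
  rfl

theorem convExp_convPostcomp {φ : WithConv (D →ₗ[k] A)} (hφ : IsLocallyNilpotent φ)
    (g : A →ₐ[k] B) : convExp (hφ.convPostcomp g) = convPostcomp D g (convExp hφ) := by
  ext x
  have polyConvExp_apply : polyConvExp (hφ.convPostcomp g) x =
      Polynomial.map (g : A →+* B) (polyConvExp hφ x) := by
    ext n
    rw [coeff_polyConvExp, coeff_map, coeff_polyConvExp, ← map_pow]
    exact (map_smul g _ _).symm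
  change aeval (1 : B) (polyConvExp _ x) = g (aeval (1 : A) (polyConvExp hφ x))
  rw [polyConvExp_apply, coe_aeval_eq_eval, coe_aeval_eq_eval, Polynomial.eval_map,
    ← map_one (g : A →+* B), Polynomial.eval₂_at_apply]
  rfl

theorem convExp_of_mul_self_eq_zero {φ : WithConv (D →ₗ[k] A)} (hφ : IsLocallyNilpotent φ)
    (h : φ * φ = 0) : convExp hφ = 1 + φ := by
  ext x
  have polyConvExp_apply : polyConvExp hφ x = C ((1 : WithConv (D →ₗ[k] A)) x) + C (φ x) * X := by
    ext n
    rw [coeff_polyConvExp]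
    rcases n with _ | _ | n
    · simp
    · simp
    · rw [add_assoc, pow_add, one_add_one_eq_two, pow_two, h, mul_zero]
      simp [coeff_C, coeff_X]
  change aeval (1 : A) (polyConvExp hφ x) = _
  rw [polyConvExp_apply]
  simp

end ConvolutionExponential

section PrimitiveValued

variable {k D A : Type u} [Field k] [AddCommGroup D] [Module k D] [Coalgebra k D] [CommRing A]
  [Bialgebra k A] {φ : WithConv (D →ₗ[k] A)} (hφ : IsLocallyNilpotent φ)

theorem counit_convExp (hprim : ∀ x, φ x ∈ primitives k (1 : A)) (x : D) :
    Coalgebra.counit (R := k) (convExp hφ x) = Coalgebra.counit (R := k) x := by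
  have one_isGroupLike : IsGroupLikeElem k (1 : A) := IsGroupLikeElem.one
  have counit_comp : convPostcomp D (Bialgebra.counitAlgHom k A) φ = 0 :=
    WithConv.ext (LinearMap.ext fun y =>
      counit_eq_zero_of_mem_primitives one_isGroupLike (hprim y))
  calc Coalgebra.counit (R := k) (convExp hφ x)
      = convPostcomp D (Bialgebra.counitAlgHom k A) (convExp hφ) x := rfl
    _ = Coalgebra.counit (R := k) x := by
      rw [← convExp_convPostcomp,
        convExp_of_mul_self_eq_zero _ (by rw [counit_comp, mul_zero]), counit_comp, add_zero]
      simp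

theorem comul_convExp [CharZero k] [Coalgebra.IsCocomm k D]
    (hprim : ∀ x, φ x ∈ primitives k (1 : A)) (x : D) :
    TensorProduct.map (convExp hφ).ofConv (convExp hφ).ofConv (Coalgebra.comul (R := k) x) =
      Coalgebra.comul (R := k) (convExp hφ x) := by
  let left : A →ₐ[k] A ⊗[k] A := Algebra.TensorProduct.includeLeft
  let right : A →ₐ[k] A ⊗[k] A := Algebra.TensorProduct.includeRight
  have comul_comp : convPostcomp D (Bialgebra.comulAlgHom k A) φ =
      convPostcomp D left φ + convPostcomp D right φ :=
    WithConv.ext (LinearMap.ext fun y => mem_primitives.1 (hprim y))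
  have mul_left_right (F : WithConv (D →ₗ[k] A)) :
      LinearMap.mul' k (A ⊗[k] A) ∘ₗ TensorProduct.map
        (convPostcomp D left F).ofConv (convPostcomp D right F).ofConv =
          TensorProduct.map F.ofConv F.ofConv :=
    TensorProduct.ext' fun y z => by
      simp [convPostcomp_apply, left, right]
  calc TensorProduct.map (convExp hφ).ofConv (convExp hφ).ofConv (Coalgebra.comul (R := k) x)
      = (convPostcomp D left (convExp hφ) * convPostcomp D right (convExp hφ)) x := by
        rw [LinearMap.convMul_apply, ← mul_left_right, LinearMap.comp_apply]
    _ = convPostcomp D (Bialgebra.comulAlgHom k A) (convExp hφ) x := by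
        simp only [← convExp_convPostcomp]
        rw [← convExp_add _ _ (comul_comp ▸ hφ.convPostcomp _)]
        simp only [comul_comp]
    _ = Coalgebra.comul (R := k) (convExp hφ x) := rfl

/-- The exponential of a function with primitive values in a commutative bialgebra, as a coalgebra
morphism. -/
def convExpCoalgHom [CharZero k] [Coalgebra.IsCocomm k D]
    (hprim : ∀ x, φ x ∈ primitives k (1 : A)) : D →ₗc[k] A :=
  { (convExp hφ).ofConv with
    counit_comp := LinearMap.ext (counit_convExp hφ hprim)
    map_comp_comul := LinearMap.ext (comul_convExp hφ hprim) }

end PrimitiveValued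

/-! ### Cofreeness of the symmetric coalgebra -/

section Cofree

variable {k : Type u} [Field k]
  {D S : Type u} [AddCommGroup D] [Module k D] [Coalgebra k D] {e : D}
  [AddCommGroup S] [Module k S] [Coalgebra k S] {s : S}

theorem IsConilpotent.coalgHom_ext (he : IsConilpotent k e) (hs : IsConilpotent k s)
    {F G : D →ₗc[k] S} (h : ∀ x, F x - G x ∈ primitives k s → F x = G x) : F = G := by
  have map_pt (F : D →ₗc[k] S) : F e = s := hs.eq_of_isGroupLike (he.isGroupLike.map F)
  have eqOn_primFiltration (n) : ∀ x ∈ primFiltration k e n, F x = G x := by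
    induction n with
    | zero =>
      intro x hx
      obtain ⟨c, rfl⟩ := Submodule.mem_span_singleton.1 hx
      rw [map_smul, map_smul, map_pt, map_pt]
    | succ n ih =>
      intro x hx
      have map_reduced_eq :
          TensorProduct.map (F : D →ₗ[k] S) (F : D →ₗ[k] S) (reducedComul k e x) =
            TensorProduct.map (G : D →ₗ[k] S) (G : D →ₗ[k] S) (reducedComul k e x) := by
        refine range_map_le k _ (LinearMap.eqLocus _ _) (fun a ha b hb => ?_) hx
        rw [LinearMap.mem_eqLocus, TensorProduct.map_tmul, TensorProduct.map_tmul]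
        exact congrArg₂ _ (ih a ha) (ih b hb)
      rw [map_reducedComul, map_reducedComul, map_pt, map_pt] at map_reduced_eq
      exact h x (by rw [primitives, LinearMap.mem_ker, map_sub, map_reduced_eq, sub_self])
  refine DFunLike.ext _ _ fun x => ?_
  obtain ⟨n, hn⟩ := he.exhaustive x
  exact eqOn_primFiltration n x hn

variable {V : Type u} [AddCommGroup V] [Module k V]

theorem ι_mem_primitives (v : V) :
    SymmetricAlgebra.ι k V v ∈ primitives k (1 : SymmetricAlgebra k V) :=
  mem_primitives.2 (SymmetricAlgebra.comul_ι k V v)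

variable [CharZero k]

theorem eq_zero_of_mem_primitives_sym {x : SymmetricAlgebra k V} (hx : x ∈ primitives k 1)
    (h : symProj k V x = 0) : x = 0 := by
  obtain ⟨v, rfl⟩ := primitives_sym_le k V hx
  have : v = 0 := (symProj_ι k V v).symm.trans h
  rw [this, map_zero]

theorem exists_coalgHom_symProj_eq [Coalgebra.IsCocomm k D] (he : IsConilpotent k e)
    (φ : D →ₗ[k] V) (hφ : φ e = 0) :
    ∃ F : D →ₗc[k] SymmetricAlgebra k V, ∀ x, symProj k V (F x) = φ x := by
  let ιφ : WithConv (D →ₗ[k] SymmetricAlgebra k V) := WithConv.toConv (SymmetricAlgebra.ι k V ∘ₗ φ)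
  have ιφ_nilpotent : IsLocallyNilpotent ιφ :=
    he.isLocallyNilpotent ((congrArg _ hφ).trans (map_zero (SymmetricAlgebra.ι k V)))
  refine ⟨convExpCoalgHom ιφ_nilpotent fun x => ι_mem_primitives (φ x), fun x => ?_⟩
  -- `symProj` is read off an algebra morphism to dual numbers, where the exponential is `1 + φ`.
  let : Module kᵐᵒᵖ V := Module.compHom _ ((RingHom.id k).fromOpposite mul_comm)
  have : IsCentralScalar k V := ⟨fun r m => rfl⟩
  let g : SymmetricAlgebra k V →ₐ[k] TrivSqZeroExt k V :=
    SymmetricAlgebra.lift (TrivSqZeroExt.inrHom k V)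
  have g_ι (v : V) : g (SymmetricAlgebra.ι k V v) = TrivSqZeroExt.inr v :=
    SymmetricAlgebra.lift_ι_apply _ _
  have mul_self : convPostcomp D g ιφ * convPostcomp D g ιφ = 0 := by
    ext y : 2
    refine ((Coalgebra.Repr.arbitrary k y).convMul_apply _ _).trans
      (Finset.sum_eq_zero fun i _ => ?_)
    change g (SymmetricAlgebra.ι k V _) * g (SymmetricAlgebra.ι k V _) = 0
    rw [g_ι, g_ι, TrivSqZeroExt.inr_mul_inr]
  calc symProj k V (convExp ιφ_nilpotent x)
      = (convPostcomp D g (convExp ιφ_nilpotent) x).snd := rfl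
    _ = φ x := by
      rw [← convExp_convPostcomp, convExp_of_mul_self_eq_zero _ mul_self]
      change (algebraMap k (TrivSqZeroExt k V) (Coalgebra.counit (R := k) x) +
        g (SymmetricAlgebra.ι k V (φ x))).snd = φ x
      rw [g_ι]
      simp [TrivSqZeroExt.algebraMap_eq_inl]

theorem isCofree_symCo [Module.Finite k V] : IsCofree (symCo k V) (symCo.proj k V) where
  map_pt := symProj_one k V
  existsUnique_lift D _ _ _ _ d hd φ hφ := by
    obtain ⟨F, hF⟩ := exists_coalgHom_symProj_eq hd φ hφ
    refine ⟨F, LinearMap.ext hF, fun G hG =>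
      hd.coalgHom_ext (isConilpotent_sym k V) fun x hx => ?_⟩
    refine sub_eq_zero.1 (eq_zero_of_mem_primitives_sym hx ?_)
    rw [map_sub, sub_eq_zero]
    exact (LinearMap.congr_fun hG x).trans (hF x).symm

end Cofree

/-! ### Ideals of the dual algebra -/

section DualIdeal

variable {k C D : Type u} [Field k] [AddCommGroup C] [Module k C] [Coalgebra k C]
  [AddCommGroup D] [Module k D] [Coalgebra k D]

/-- The contraction `x ↦ g(x₁) x₂`, the transpose of multiplication by `g` in the dual algebra. -/
def contraction (g : WithConv (C →ₗ[k] k)) : C →ₗ[k] C :=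
  (TensorProduct.lid k C).toLinearMap ∘ₗ g.ofConv.rTensor C ∘ₗ Coalgebra.comul

theorem apply_contraction (g h : WithConv (C →ₗ[k] k)) (x : C) :
    h (contraction g x) = (g * h) x :=
  (apply_lid_rTensor g.ofConv h.ofConv _).trans (LinearMap.convMul_apply g h x).symm

theorem mul'_map_reducedComul (e : C) (φ ψ : WithConv (C →ₗ[k] k)) (x : C) :
    LinearMap.mul' k k (TensorProduct.map φ.ofConv ψ.ofConv (reducedComul k e x)) =
      (φ * ψ) x - φ x * ψ e - φ e * ψ x := by
  rw [reducedComul_apply, LinearMap.convMul_apply]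
  simp

theorem exists_dualMap_eq {X Y : Type*} [AddCommGroup X] [Module k X] [AddCommGroup Y] [Module k Y]
    (γ : Module.Dual k X →ₗ[k] Module.Dual k Y) (E : Submodule k X) [Module.Finite k E]
    (h : E.dualAnnihilator ≤ LinearMap.ker γ) : ∃ w : Y →ₗ[k] X, w.dualMap = γ := by
  obtain ⟨p, hp⟩ := E.subtype.exists_leftInverse_of_injective E.ker_subtype
  let w : Y →ₗ[k] X :=
    E.subtype ∘ₗ (Module.evalEquiv k E).symm.toLinearMap ∘ₗ LinearMap.flip (γ ∘ₗ p.dualMap)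
  refine ⟨w, LinearMap.ext fun φ => LinearMap.ext fun y => ?_⟩
  have congr_mod_annihilator : γ (p.dualMap (φ ∘ₗ E.subtype)) = γ φ := by
    rw [← sub_eq_zero, ← map_sub]
    refine h ((Submodule.mem_dualAnnihilator _).2 fun x hx => ?_)
    have : p x = ⟨x, hx⟩ := LinearMap.congr_fun hp ⟨x, hx⟩
    simp [this]
  calc φ (w y) = Module.evalEquiv k E ((Module.evalEquiv k E).symm
        (LinearMap.flip (γ ∘ₗ p.dualMap) y)) (φ ∘ₗ E.subtype) := rfl
    _ = γ (p.dualMap (φ ∘ₗ E.subtype)) y := by rw [LinearEquiv.apply_symm_apply]; rfl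
    _ = γ φ y := by rw [congr_mod_annihilator]

theorem exists_coalgHom_of_transpose {w : D →ₗ[k] C}
    {γ : WithConv (C →ₗ[k] k) →ₐ[k] WithConv (D →ₗ[k] k)} (h : ∀ φ x, φ (w x) = γ φ x) :
    ∃ F : D →ₗc[k] C, (F : D →ₗ[k] C) = w := by
  have transpose_eq (φ : Module.Dual k C) : (γ (WithConv.toConv φ)).ofConv = φ ∘ₗ w :=
    LinearMap.ext fun y => (h (WithConv.toConv φ) y).symm
  refine ⟨{ w with counit_comp := LinearMap.ext fun x => ?_, map_comp_comul := ?_ }, rfl⟩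
  · exact (h 1 x).trans (by rw [map_one]; rfl)
  · refine LinearMap.ext fun x => tensor_ext_dual fun φ ψ => ?_
    have map_convMul := h (WithConv.toConv φ * WithConv.toConv ψ) x
    rw [map_mul, LinearMap.convMul_apply, LinearMap.convMul_apply, transpose_eq, transpose_eq,
      TensorProduct.map_comp, LinearMap.comp_apply] at map_convMul
    exact map_convMul.symm

/-- The elements killed by all functionals of an ideal of the dual algebra. -/
def coannihilator (I : Ideal (WithConv (C →ₗ[k] k))) : Submodule k C :=
  ((I.restrictScalars k).map (WithConv.linearEquiv k (C →ₗ[k] k)).toLinearMap).dualCoannihilator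

theorem mem_coannihilator {I : Ideal (WithConv (C →ₗ[k] k))} {x : C} :
    x ∈ coannihilator I ↔ ∀ f ∈ I, f x = 0 := by
  rw [coannihilator, Submodule.mem_dualCoannihilator]
  exact Set.forall_mem_image

variable [Coalgebra.IsCocomm k C]

theorem isSubcoalgebra_coannihilator (I : Ideal (WithConv (C →ₗ[k] k))) :
    IsSubcoalgebra k (coannihilator I) := fun x hx => by
  rw [mem_coannihilator] at hx
  refine mem_range_map_dualCoannihilator _ _ ?_ ?_
  · rintro _ ⟨φ, hφ, rfl⟩ ψ
    exact hx _ (I.mul_mem_right (WithConv.toConv ψ) hφ)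
  · rintro _ ⟨φ, hφ, rfl⟩ ψ
    exact hx _ (I.mul_mem_left (WithConv.toConv ψ) hφ)

/-- Finitely generated ideals of the dual algebra are closed: the elements killed by `g₁, …, gₙ` and
their multiples form the kernel of the contractions with `g₁, …, gₙ`, and a functional that vanishes
on a kernel factors through the map. -/
theorem mem_of_forall_coannihilator {I : Ideal (WithConv (C →ₗ[k] k))} (hI : I.FG)
    (f : WithConv (C →ₗ[k] k)) (hf : ∀ x ∈ coannihilator I, f x = 0) : f ∈ I := by
  classical
  obtain ⟨s, rfl⟩ := hI
  let T : C →ₗ[k] (s → C) := LinearMap.pi fun g => contraction (g : WithConv (C →ₗ[k] k))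
  have ker_le : LinearMap.ker T ≤ coannihilator (Ideal.span s) := fun x hx =>
    mem_coannihilator.2 fun φ hφ => by
      obtain ⟨c, -, rfl⟩ := Submodule.mem_span_finset.1 hφ
      rw [WithConv.ofConv_sum, LinearMap.sum_apply]
      refine Finset.sum_eq_zero fun g hg => ?_
      have contraction_eq : contraction g x = 0 := congrFun hx ⟨g, hg⟩
      exact (congrArg (fun ψ : WithConv (C →ₗ[k] k) => ψ x) (mul_comm (c g) g)).trans
        (by rw [← apply_contraction, contraction_eq, map_zero])
  have mem_range : f.ofConv ∈ LinearMap.range T.dualMap := by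
    rw [LinearMap.range_dualMap_eq_dualAnnihilator_ker, Submodule.mem_dualAnnihilator]
    exact fun x hx => hf x (ker_le hx)
  obtain ⟨h, hh⟩ := mem_range
  let coeff (g : s) : WithConv (C →ₗ[k] k) :=
    WithConv.toConv (h ∘ₗ LinearMap.single k (fun _ : s => C) g)
  have expand : f = ∑ g : s, (g : WithConv (C →ₗ[k] k)) * coeff g := by
    ext x
    rw [← hh, WithConv.ofConv_sum, LinearMap.sum_apply, LinearMap.dualMap_apply,
      ← LinearMap.sum_single_apply (fun _ => C) (T x), map_sum]
    exact Finset.sum_congr rfl fun g _ => apply_contraction _ (coeff g) x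
  rw [expand]
  exact Ideal.sum_mem _ fun g _ => Ideal.mul_mem_right _ _ (Ideal.subset_span g.2)

theorem coannihilator_pow_le_primFiltration {e : C} (he : IsGroupLikeElem k e)
    {I : Ideal (WithConv (C →ₗ[k] k))} (hI : ∀ f, f ∈ I ↔ f e = 0) (n : ℕ) :
    coannihilator (I ^ (n + 1)) ≤ primFiltration k e n := by
  induction n with
  | zero =>
    intro x hx
    by_contra hx₀
    obtain ⟨f, hf, hle⟩ := Submodule.exists_le_ker_of_notMem hx₀
    refine hf (mem_coannihilator.1 hx (WithConv.toConv f) (Eq.ge (pow_one I) ?_))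
    exact (hI _).2 (hle (Submodule.mem_span_singleton_self e))
  | succ n ih =>
    intro x hx
    rw [mem_coannihilator] at hx
    have convMul_eq (φ) (hφ : φ ∈ I ^ (n + 1)) (ψ : WithConv (C →ₗ[k] k)) :
        φ e = 0 ∧ (φ * ψ) x = φ x * ψ e := by
      have sub_mem : ψ - ψ e • 1 ∈ I :=
        (hI _).2 (by simp [he.counit_eq_one])
      have mul_sub_eq := hx _ (Ideal.mul_mem_mul hφ sub_mem)
      rw [mul_sub, mul_smul_comm, mul_one] at mul_sub_eq
      refine ⟨(hI φ).1 (Ideal.pow_le_self n.succ_ne_zero hφ), ?_⟩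
      rw [mul_comm (φ x)]
      exact sub_eq_zero.1 mul_sub_eq
    refine TensorProduct.range_mapIncl_mono ih ih (mem_range_map_dualCoannihilator _ _ ?_ ?_)
    all_goals
      rintro _ ⟨φ, hφ, rfl⟩ ψ
      obtain ⟨φ_pt, φ_mul⟩ := convMul_eq φ hφ (WithConv.toConv ψ)
    · exact (mul'_map_reducedComul e φ (WithConv.toConv ψ) x).trans (by rw [φ_mul, φ_pt]; simp)
    · refine (mul'_map_reducedComul e (WithConv.toConv ψ) φ x).trans ?_
      rw [mul_comm, φ_mul, φ_pt]
      simp [mul_comm]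

end DualIdeal

/-! ### The dual algebra of an object -/

namespace FunAlg

variable {k : Type u} [Field k] {C D : CoCom k}

theorem mem_maxIdeal {φ : FunAlg C} : φ ∈ maxIdeal C ↔ φ C.pt = 0 := Iff.rfl

theorem apply_eq_zero_of_mem_maxIdeal_pow (n : ℕ) :
    ∀ f ∈ maxIdeal C ^ 2 ^ n, ∀ x ∈ primFiltration k C.pt n, f x = 0 := by
  induction n with
  | zero =>
    intro f hf x hx
    rw [pow_zero, pow_one, mem_maxIdeal] at hf
    obtain ⟨c, rfl⟩ := Submodule.mem_span_singleton.1 hx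
    rw [map_smul, hf, smul_zero]
  | succ n ih =>
    intro f hf
    rw [pow_succ, mul_two, pow_add] at hf
    refine Submodule.mul_induction_on hf (fun a ha b hb => ?_) (fun a b ha hb x hx => ?_)
    · exact convMul_apply_eq_zero C.isConilpotent.isGroupLike (ih a ha) (ih b hb)
    · exact (congrArg₂ _ (ha x hx) (hb x hx)).trans (add_zero 0)

theorem map_apply (f : C ⟶ D) (φ : FunAlg D) (x : C.carrier) : (map f φ) x = φ (f.hom x) := rfl

theorem map_algebraMap (f : C ⟶ D) (c : k) :
    map f (algebraMap k (FunAlg D) c) = algebraMap k (FunAlg C) c := by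
  ext x
  rw [map_apply, LinearMap.convAlgebraMap_apply, LinearMap.convAlgebraMap_apply,
    CoalgHomClass.counit_comp_apply]

theorem hom_eq_of_map_eq {f g : C ⟶ D} (h : map f = map g) : f = g := by
  refine CoCom.hom_ext fun x => sub_eq_zero.1 ((Module.forall_dual_apply_eq_zero_iff k _).1
    fun φ => ?_)
  rw [map_sub, sub_eq_zero]
  exact congrArg (fun F => F (WithConv.toConv φ) x) h

theorem map_surjective {f : C ⟶ D} (hf : Function.Injective f.hom) :
    Function.Surjective (map f) := fun φ => by
  obtain ⟨ψ, hψ⟩ := LinearMap.dualMap_surjective_of_injective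
    (f := (f.hom : C.carrier →ₗ[k] D.carrier)) hf φ.ofConv
  exact ⟨WithConv.toConv ψ, WithConv.ext hψ⟩

theorem injective_of_map_surjective {f : C ⟶ D} (h : Function.Surjective (map f)) :
    Function.Injective f.hom := by
  refine LinearMap.dualMap_surjective_iff (f := (f.hom : C.carrier →ₗ[k] D.carrier)).1 fun φ => ?_
  obtain ⟨ψ, hψ⟩ := h (WithConv.toConv φ)
  exact ⟨ψ.ofConv, congrArg WithConv.ofConv hψ⟩

theorem maxIdeal_pow_le_comap (f : C ⟶ D) (n : ℕ) :
    maxIdeal D ^ n ≤ (maxIdeal C ^ n).comap (map f) := by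
  have map_mem (φ : FunAlg D) (h : φ ∈ maxIdeal D) : map f φ ∈ maxIdeal C := by
    rw [mem_maxIdeal] at h ⊢
    rw [map_apply, CoCom.Hom.map_pt, h]
  exact (Ideal.pow_right_mono map_mem n).trans (Ideal.le_comap_pow _ n)

theorem exists_maxIdeal_pow_eq_bot (C : CoCom k) [Module.Finite k C.carrier] :
    ∃ n, maxIdeal C ^ n = ⊥ := by
  obtain ⟨s, hs⟩ := Module.Finite.fg_top (R := k) (M := C.carrier)
  choose N hN using C.isConilpotent.exhaustive
  have top_le : ⊤ ≤ primFiltration k C.pt (s.sup N) := hs ▸ Submodule.span_le.2 fun y hy =>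
    primFiltration_mono C.isConilpotent.isGroupLike (Finset.le_sup (f := N) hy) (hN y)
  refine ⟨2 ^ s.sup N, (Submodule.eq_bot_iff _).2 fun f hf => ?_⟩
  ext x
  exact apply_eq_zero_of_mem_maxIdeal_pow _ f hf x (top_le trivial)

/-- On the subcoalgebra killed by `I`, which has no primitive elements, every function is constant;
finitely generated ideals are closed. -/
theorem maxIdeal_le_of_coannihilator_inf_prim_eq_bot {I : Ideal (FunAlg C)} (hfg : I.FG)
    (hle : I ≤ maxIdeal C) (h : coannihilator I ⊓ Prim C = ⊥) : maxIdeal C ≤ I := by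
  have hpt : C.pt ∈ coannihilator I := mem_coannihilator.2 fun f hf => hle hf
  let W := C.sub (coannihilator I) (isSubcoalgebra_coannihilator I) hpt
  let i : W ⟶ C := C.subι _ _ hpt
  have prim_eq_bot : Prim W = ⊥ := (Submodule.eq_bot_iff _).2 fun x hx => by
    refine C.subι_injective _ _ hpt (((Submodule.eq_bot_iff _).1 h (i.hom x)
      ⟨C.subι_mem _ _ hpt x, (Prim.map i ⟨x, hx⟩).2⟩).trans (map_zero i.hom).symm)
  refine fun f hf => mem_of_forall_coannihilator hfg f fun y hy => ?_
  rw [← C.range_subι _ (isSubcoalgebra_coannihilator I) hpt] at hy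
  obtain ⟨z, rfl⟩ := hy
  have z_eq := W.isConilpotent.eq_counit_smul prim_eq_bot z
  have map_z : i.hom z = Coalgebra.counit (R := k) z • C.pt := by
    conv_lhs => rw [z_eq]
    rw [map_smul, CoCom.Hom.map_pt]
  exact (congrArg f.ofConv map_z).trans (by rw [map_smul, mem_maxIdeal.1 hf, smul_zero])

end FunAlg

theorem exists_lift_extend_prim {k : Type u} [Field k] {C : CoCom k} {K K' : Type*}
    [AddCommGroup K] [Module k K] [AddCommGroup K'] [Module k K'] {p : K →ₗ[k] K'}
    (hp : Function.Surjective p) (ℓ : Prim C →ₗ[k] K) {b : C.carrier →ₗ[k] K'} (b_pt : b C.pt = 0)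
    (h : ∀ x, p (ℓ x) = b x) :
    ∃ ℓ' : C.carrier →ₗ[k] K, (∀ x : Prim C, ℓ' x = ℓ x) ∧ ℓ' C.pt = 0 ∧ p ∘ₗ ℓ' = b := by
  have he := C.isConilpotent.isGroupLike
  obtain ⟨g, g_prim, p_g⟩ := exists_linearMap_lift (Prim C).injective_subtype hp ℓ b
    (LinearMap.ext h)
  have p_g_pt : p (g C.pt) = 0 := (LinearMap.congr_fun p_g C.pt).trans b_pt
  refine ⟨g - (Coalgebra.counit (R := k)).smulRight (g C.pt), fun x => ?_, ?_, ?_⟩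
  · rw [LinearMap.sub_apply, LinearMap.smulRight_apply, counit_eq_zero_of_mem_primitives he x.2,
      zero_smul, sub_zero]
    exact LinearMap.congr_fun g_prim x
  · simp [he.counit_eq_one]
  · ext x
    rw [← p_g]
    simp [p_g_pt]

theorem exists_extend_prim {k : Type u} [Field k] {C : CoCom k} {K : Type*} [AddCommGroup K]
    [Module k K] (ℓ : Prim C →ₗ[k] K) :
    ∃ ℓ' : C.carrier →ₗ[k] K, (∀ x : Prim C, ℓ' x = ℓ x) ∧ ℓ' C.pt = 0 := by
  obtain ⟨ℓ', hℓ', ℓ'_pt, -⟩ := exists_lift_extend_prim (p := (0 : K →ₗ[k] PUnit))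
    (fun _ => ⟨0, rfl⟩) ℓ (b := 0) rfl fun _ => rfl
  exact ⟨ℓ', hℓ', ℓ'_pt⟩

namespace FunAlg

variable {k : Type u} [Field k] {C D : CoCom k}

theorem maxIdeal_fg (C : CoCom k) : (maxIdeal C).FG := by
  have := C.finiteType
  let b := Module.finBasis k (Prim C)
  choose x hx hx₀ using fun i => exists_extend_prim (b.coord i)
  let g (i) : FunAlg C := WithConv.toConv (x i)
  have span_fg : (Ideal.span (Set.range g)).FG := Submodule.fg_span (Set.finite_range g)
  have span_le : Ideal.span (Set.range g) ≤ maxIdeal C := by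
    rw [Ideal.span_le]
    rintro _ ⟨i, rfl⟩
    exact hx₀ i
  refine (span_le.antisymm (maxIdeal_le_of_coannihilator_inf_prim_eq_bot span_fg span_le ?_)) ▸
    span_fg
  refine (Submodule.eq_bot_iff _).2 fun p ⟨hpW, hp⟩ => congrArg Subtype.val (b.ext_elem
    (x := ⟨p, hp⟩) (y := 0) fun i => ?_)
  rw [map_zero, Finsupp.zero_apply, ← Module.Basis.coord_apply, ← hx]
  exact mem_coannihilator.1 hpW (g i) (Ideal.subset_span ⟨i, rfl⟩)

theorem exists_finite_forall_mem_maxIdeal_pow (C : CoCom k) (n : ℕ) :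
    ∃ E : Submodule k C.carrier, Module.Finite k E ∧
      ∀ φ : FunAlg C, (∀ x ∈ E, φ x = 0) → φ ∈ maxIdeal C ^ n := by
  have := C.finiteType
  have := finite_primFiltration (k := k) (e := C.pt) n
  exact ⟨coannihilator (maxIdeal C ^ (n + 1)),
    Submodule.finiteDimensional_of_le
      (coannihilator_pow_le_primFiltration C.isConilpotent.isGroupLike (fun _ => Iff.rfl) n),
    fun φ hφ => Ideal.pow_le_pow_right n.le_succ
      (mem_of_forall_coannihilator (maxIdeal_fg C).pow φ hφ)⟩

theorem exists_map_eq (γ : FunAlg C →ₐ[k] FunAlg D)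
    (hγ : ∃ n, maxIdeal C ^ n ≤ RingHom.ker γ) : ∃ w : D ⟶ C, map w = γ := by
  obtain ⟨n, hn⟩ := hγ
  obtain ⟨E, hE, mem_pow⟩ := exists_finite_forall_mem_maxIdeal_pow C n
  let γ' : Module.Dual k C.carrier →ₗ[k] Module.Dual k D.carrier :=
    (WithConv.linearEquiv k _).toLinearMap ∘ₗ γ.toLinearMap ∘ₗ
      (WithConv.linearEquiv k _).symm.toLinearMap
  obtain ⟨w, hw⟩ := exists_dualMap_eq γ' E fun φ hφ => LinearMap.mem_ker.2 <|
    congrArg WithConv.ofConv (hn (mem_pow (WithConv.toConv φ)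
      ((Submodule.mem_dualAnnihilator φ).1 hφ)))
  obtain ⟨F, hF⟩ := exists_coalgHom_of_transpose (w := w) (γ := γ) fun φ x =>
    congrArg (fun χ : Module.Dual k C.carrier →ₗ[k] Module.Dual k D.carrier => χ φ.ofConv x) hw
  refine ⟨⟨F⟩, RingHom.ext fun φ => WithConv.ext ?_⟩
  exact (congrArg (φ.ofConv ∘ₗ ·) hF).trans (LinearMap.congr_fun hw φ.ofConv)

end FunAlg

/-! ### The coalgebra dual to a finite-dimensional algebra -/

section DualCoalgebra

open TensorProduct (dualDistrib dualDistribEquiv dualDistrib_apply)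

variable {k B : Type u} [Field k] [CommRing B] [Algebra k B]

theorem mul'_map_eval (t : Module.Dual k B ⊗[k] Module.Dual k B) (a b : B) :
    LinearMap.mul' k k (TensorProduct.map (Module.Dual.eval k B a) (Module.Dual.eval k B b) t) =
      dualDistrib k B B t (a ⊗ₜ b) := by
  induction t with
  | zero => simp
  | add x y hx hy => simp only [map_add, hx, hy, LinearMap.add_apply]
  | tmul x y => simp

variable [Module.Finite k B]

variable (k B) in
/-- The comultiplication dual to the multiplication of a finite-dimensional algebra. -/
def dualComul : Module.Dual k B →ₗ[k] Module.Dual k B ⊗[k] Module.Dual k B :=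
  (dualDistribEquiv k B B).symm.toLinearMap ∘ₗ (LinearMap.mul' k B).dualMap

theorem dualDistrib_dualComul (ξ : Module.Dual k B) (a b : B) :
    dualDistrib k B B (dualComul k B ξ) (a ⊗ₜ b) = ξ (a * b) := by
  have h : dualDistribEquiv k B B (dualComul k B ξ) = (LinearMap.mul' k B).dualMap ξ :=
    LinearEquiv.apply_symm_apply _ _
  exact LinearMap.congr_fun h (a ⊗ₜ b)

theorem dualDistrib_ext {s t : Module.Dual k B ⊗[k] Module.Dual k B}
    (h : ∀ a b, dualDistrib k B B s (a ⊗ₜ b) = dualDistrib k B B t (a ⊗ₜ b)) : s = t :=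
  (dualDistribEquiv k B B).injective (TensorProduct.ext' h)

variable (k B) in
/-- The canonical isomorphism `B* ⊗ (B* ⊗ B*) ≃ (B ⊗ (B ⊗ B))*` for a finite-dimensional `B`. -/
def dualDistribEquiv₃ : Module.Dual k B ⊗[k] (Module.Dual k B ⊗[k] Module.Dual k B) ≃ₗ[k]
    Module.Dual k (B ⊗[k] (B ⊗[k] B)) :=
  LinearEquiv.lTensor _ (dualDistribEquiv k B B) ≪≫ₗ dualDistribEquiv k B (B ⊗[k] B)

theorem dualDistribEquiv₃_tmul (ξ : Module.Dual k B) (t : Module.Dual k B ⊗[k] Module.Dual k B)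
    (a : B) (s : B ⊗[k] B) :
    dualDistribEquiv₃ k B (ξ ⊗ₜ t) (a ⊗ₜ s) = ξ a * dualDistrib k B B t s := rfl

theorem dualDistribEquiv₃_lTensor_dualComul (t : Module.Dual k B ⊗[k] Module.Dual k B)
    (a b c : B) : dualDistribEquiv₃ k B ((dualComul k B).lTensor _ t) (a ⊗ₜ (b ⊗ₜ c)) =
      dualDistrib k B B t (a ⊗ₜ (b * c)) := by
  induction t with
  | zero => simp
  | add x y hx hy => simp only [map_add, hx, hy, LinearMap.add_apply]
  | tmul x y =>
    rw [LinearMap.lTensor_tmul, dualDistribEquiv₃_tmul, dualDistrib_dualComul, dualDistrib_apply]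

theorem dualDistribEquiv₃_assoc_tmul (s : Module.Dual k B ⊗[k] Module.Dual k B)
    (y : Module.Dual k B) (a b c : B) :
    dualDistribEquiv₃ k B (TensorProduct.assoc k _ _ _ (s ⊗ₜ y)) (a ⊗ₜ (b ⊗ₜ c)) =
      dualDistrib k B B s (a ⊗ₜ b) * y c := by
  induction s with
  | zero => simp
  | add s t hs ht =>
    simp only [map_add, hs, ht, LinearMap.add_apply, TensorProduct.add_tmul, add_mul]
  | tmul x z =>
    rw [TensorProduct.assoc_tmul, dualDistribEquiv₃_tmul, dualDistrib_apply, dualDistrib_apply,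
      mul_assoc]

theorem dualDistribEquiv₃_assoc_rTensor_dualComul (t : Module.Dual k B ⊗[k] Module.Dual k B)
    (a b c : B) :
    dualDistribEquiv₃ k B (TensorProduct.assoc k _ _ _ ((dualComul k B).rTensor _ t))
      (a ⊗ₜ (b ⊗ₜ c)) = dualDistrib k B B t ((a * b) ⊗ₜ c) := by
  induction t with
  | zero => simp
  | add x y hx hy => simp only [map_add, hx, hy, LinearMap.add_apply]
  | tmul x y =>
    rw [LinearMap.rTensor_tmul, dualDistribEquiv₃_assoc_tmul, dualDistrib_dualComul,
      dualDistrib_apply]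

variable (k B) in
/-- The coalgebra structure on the dual of a finite-dimensional algebra. -/
@[reducible] def dualCoalgebra : Coalgebra k (Module.Dual k B) where
  comul := dualComul k B
  counit := Module.Dual.eval k B 1
  coassoc := by
    refine LinearMap.ext fun ξ => (dualDistribEquiv₃ k B).injective (TensorProduct.ext
      (LinearMap.ext fun a => TensorProduct.ext' fun b c => ?_))
    refine (dualDistribEquiv₃_assoc_rTensor_dualComul _ a b c).trans
      (Eq.trans ?_ (dualDistribEquiv₃_lTensor_dualComul _ a b c).symm)
    rw [dualDistrib_dualComul, dualDistrib_dualComul, mul_assoc]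
  rTensor_counit_comp_comul := by
    refine LinearMap.ext fun ξ => (TensorProduct.lid k _).injective (LinearMap.ext fun b => ?_)
    refine (apply_lid_rTensor _ (Module.Dual.eval k B b) _).trans ?_
    rw [mul'_map_eval, dualDistrib_dualComul]
    simp
  lTensor_counit_comp_comul := by
    refine LinearMap.ext fun ξ => (TensorProduct.rid k _).injective (LinearMap.ext fun b => ?_)
    refine (apply_rid_lTensor (Module.Dual.eval k B b) _ _).trans ?_
    rw [mul'_map_eval, dualDistrib_dualComul]
    simp

theorem isCocomm_dualCoalgebra :
    let := dualCoalgebra k B; Coalgebra.IsCocomm k (Module.Dual k B) := by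
  let := dualCoalgebra k B
  refine ⟨LinearMap.ext fun ξ => dualDistrib_ext fun a b => ?_⟩
  change dualDistrib k B B (TensorProduct.comm k _ _ (dualComul k B ξ)) (a ⊗ₜ b) =
    dualDistrib k B B (dualComul k B ξ) (a ⊗ₜ b)
  rw [← TensorProduct.dualDistrib_apply_comm, TensorProduct.comm_tmul, dualDistrib_dualComul,
    dualDistrib_dualComul, mul_comm]

theorem isGroupLikeElem_dualCoalgebra (aug : B →ₐ[k] k) :
    let := dualCoalgebra k B; IsGroupLikeElem k (aug.toLinearMap : Module.Dual k B) := by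
  let := dualCoalgebra k B
  refine ⟨map_one aug, dualDistrib_ext fun a b => (dualDistrib_dualComul _ a b).trans ?_⟩
  rw [dualDistrib_apply]
  exact map_mul aug a b

/-- The algebra isomorphism of a finite-dimensional algebra with the dual of its dual
coalgebra. -/
def evalDual : letI := dualCoalgebra k B; haveI := isCocomm_dualCoalgebra (k := k) (B := B)
    B ≃ₐ[k] WithConv (Module.Dual k B →ₗ[k] k) :=
  letI := dualCoalgebra k B
  haveI := isCocomm_dualCoalgebra (k := k) (B := B)
  AlgEquiv.ofLinearEquiv
    (Module.evalEquiv k B ≪≫ₗ (WithConv.linearEquiv k (Module.Dual k B →ₗ[k] k)).symm) rfl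
    fun a b => WithConv.ext (LinearMap.ext fun ξ =>
      ((mul'_map_eval (dualComul k B ξ) a b).trans (dualDistrib_dualComul ξ a b)).symm)

theorem isConilpotent_dualCoalgebra (aug : B →ₐ[k] k) (h : IsNilpotent (RingHom.ker aug)) :
    let := dualCoalgebra k B; IsConilpotent k (aug.toLinearMap : Module.Dual k B) := by
  let := dualCoalgebra k B
  have := isCocomm_dualCoalgebra (k := k) (B := B)
  refine ⟨isGroupLikeElem_dualCoalgebra aug, fun ξ => ?_⟩
  obtain ⟨n, hn⟩ := h
  let I : Ideal (WithConv (Module.Dual k B →ₗ[k] k)) := (RingHom.ker aug).map (evalDual (k := k))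
  have mem_I (f) : f ∈ I ↔ f aug.toLinearMap = 0 := by
    obtain ⟨b, rfl⟩ := (evalDual (k := k) (B := B)).surjective f
    rw [Ideal.mem_map_of_equiv]
    exact ⟨by rintro ⟨b', hb', h⟩; rw [← h]; exact hb', fun hb => ⟨b, hb, rfl⟩⟩
  have pow_eq_bot : I ^ n = ⊥ := by
    rw [← Ideal.map_pow, hn]
    exact Ideal.map_bot
  refine ⟨n, coannihilator_pow_le_primFiltration (isGroupLikeElem_dualCoalgebra aug) mem_I n
    (mem_coannihilator.2 fun f hf => ?_)⟩
  have f_eq_zero : f = 0 := pow_eq_bot.le (Ideal.pow_le_pow_right n.le_succ hf)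
  rw [f_eq_zero]
  rfl

/-- The coalgebra dual to a finite-dimensional augmented algebra with nilpotent augmentation
ideal. -/
def dualCo (aug : B →ₐ[k] k) (h : IsNilpotent (RingHom.ker aug)) : CoCom k :=
  letI := dualCoalgebra k B
  { carrier := Module.Dual k B
    isCocomm := isCocomm_dualCoalgebra
    pt := aug.toLinearMap
    isConilpotent := isConilpotent_dualCoalgebra aug h
    finiteType := inferInstance }

/-- The algebra isomorphism between an algebra and the functions on its dual coalgebra. -/
def funAlgDualCo (aug : B →ₐ[k] k) (h : IsNilpotent (RingHom.ker aug)) :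
    B ≃ₐ[k] FunAlg (dualCo aug h) := evalDual

instance (aug : B →ₐ[k] k) (h : IsNilpotent (RingHom.ker aug)) :
    Module.Finite k (dualCo aug h).carrier :=
  inferInstanceAs (Module.Finite k (Module.Dual k B))

end DualCoalgebra

/-! ### Lifting along nilpotent extensions -/

section ContinuousLifts

variable {R S : Type u} [CommRing R] [CommRing S] {I : Ideal R} {J : Ideal S} {φ : R →+* S}
  {A A₀ A₁ : Type u} [CommRing A] [CommRing A₀] [CommRing A₁]

variable (I J φ) in
/-- Commutative squares of ring homomorphisms from `φ : R → S` to `q` that are continuous for the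
`I`-adic and the `J`-adic topology and the discrete topologies on the rings of `q` have a continuous
diagonal filler. As in `IsFormallySmoothAdic`, continuity means that a power of the ideal is
killed. -/
def HasContinuousLifts (q : A →+* A₀) : Prop :=
  ∀ (α : R →+* A) (β : S →+* A₀), (∃ n : ℕ, I ^ n ≤ RingHom.ker α) →
    (∃ n : ℕ, J ^ n ≤ RingHom.ker β) → q.comp α = β.comp φ →
    ∃ γ : S →+* A, (∃ n : ℕ, J ^ n ≤ RingHom.ker γ) ∧ γ.comp φ = α ∧ q.comp γ = β

theorem exists_pow_le_ker_comp {α : R →+* A} (h : ∃ n : ℕ, I ^ n ≤ RingHom.ker α)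
    (q : A →+* A₀) : ∃ n : ℕ, I ^ n ≤ RingHom.ker (q.comp α) :=
  h.imp fun _ hn => hn.trans (RingHom.comap_ker q α ▸ Ideal.comap_mono bot_le)

theorem HasContinuousLifts.comp {q : A →+* A₁} {p : A₁ →+* A₀} (hq : HasContinuousLifts I J φ q)
    (hp : HasContinuousLifts I J φ p) : HasContinuousLifts I J φ (p.comp q) := by
  intro α β hα hβ comm
  obtain ⟨γ₁, hγ₁, γ₁_comp, rfl⟩ := hp (q.comp α) β (exists_pow_le_ker_comp hα q) hβ comm
  obtain ⟨γ, hγ, γ_comp, rfl⟩ := hq α γ₁ hα hγ₁ γ₁_comp.symm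
  exact ⟨γ, hγ, γ_comp, rfl⟩

theorem hasContinuousLifts_ringEquiv (e : A ≃+* A₀) :
    HasContinuousLifts I J φ (e : A →+* A₀) := by
  intro α β _ hβ comm
  refine ⟨(e.symm : A₀ →+* A).comp β, exists_pow_le_ker_comp hβ _, ?_, ?_⟩
  · rw [RingHom.comp_assoc, ← comm]
    exact RingHom.ext fun x => e.symm_apply_apply (α x)
  · exact RingHom.ext fun x => e.apply_symm_apply (β x)

theorem IsFormallySmoothAdic.hasContinuousLifts_mk (h : IsFormallySmoothAdic I J φ)
    {N : Ideal A} (hN : IsNilpotent N) : HasContinuousLifts I J φ (Ideal.Quotient.mk N) :=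
  Ideal.IsNilpotent.induction_on (P := fun _ _ N => HasContinuousLifts I J φ (Ideal.Quotient.mk N))
    N hN (fun A _ N hN => h A N hN) fun _ _ _ _ hle hmk hmk' =>
      (hmk.comp hmk').comp
        (hasContinuousLifts_ringEquiv (DoubleQuot.quotQuotEquivQuotOfLE hle))

theorem IsFormallySmoothAdic.hasContinuousLifts (h : IsFormallySmoothAdic I J φ) {q : A →+* A₀}
    (hq : Function.Surjective q) (hN : IsNilpotent (RingHom.ker q)) :
    HasContinuousLifts I J φ q :=
  (h.hasContinuousLifts_mk hN).comp
    (hasContinuousLifts_ringEquiv (RingHom.quotientKerEquivOfSurjective hq))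

end ContinuousLifts

/-! ### Finite-dimensional local algebras -/

section LocalAlgebra

variable {k A : Type u} [Field k] [CommRing A] [Algebra k A]

theorem exists_algHom_isNilpotent_ker [Nontrivial A] [Module.Finite k A]
    (h : ∀ a : A, ∃ c : k, IsNilpotent (a - algebraMap k A c)) :
    ∃ aug : A →ₐ[k] k, IsNilpotent (RingHom.ker aug) := by
  have : Nontrivial (A ⧸ nilradical A) := Ideal.Quotient.nontrivial_iff.2 fun eq_top =>
    not_isNilpotent_one (mem_nilradical.1 (eq_top ▸ Submodule.mem_top : (1 : A) ∈ nilradical A))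
  have bijective : Function.Bijective (Algebra.ofId k (A ⧸ nilradical A)) := by
    refine ⟨(algebraMap k _).injective, fun y => ?_⟩
    obtain ⟨a, rfl⟩ := Ideal.Quotient.mk_surjective y
    obtain ⟨c, hc⟩ := h a
    exact ⟨c, (Ideal.Quotient.eq.2 (mem_nilradical.2 hc)).symm⟩
  let e := AlgEquiv.ofBijective _ bijective
  let aug : A →ₐ[k] k := e.symm.toAlgHom.comp (Ideal.Quotient.mkₐ k (nilradical A))
  have ker_eq : RingHom.ker aug = nilradical A := Ideal.ext fun a =>
    (EmbeddingLike.map_eq_zero_iff (f := e.symm)).trans Ideal.Quotient.eq_zero_iff_mem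
  have := IsNoetherianRing.of_finite k A
  exact ⟨aug, ker_eq ▸ IsNoetherianRing.isNilpotent_nilradical A⟩

theorem exists_algHom_isNilpotent_ker_subalgebra [Nontrivial A] (B : Subalgebra k A)
    [Module.Finite k B] (h : ∀ b ∈ B, ∃ c : k, IsNilpotent (b - algebraMap k A c)) :
    ∃ aug : B →ₐ[k] k, IsNilpotent (RingHom.ker aug) :=
  exists_algHom_isNilpotent_ker fun b => (h b b.2).imp fun _ hc =>
    (IsNilpotent.map_iff (f := B.val) Subtype.val_injective).1 hc

theorem isNilpotent_of_isNilpotent_mk {A : Type*} [CommRing A] {N : Ideal A} (hN : IsNilpotent N)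
    {a : A} (h : IsNilpotent (Ideal.Quotient.mk N a)) : IsNilpotent a := by
  obtain ⟨m, hm⟩ := hN
  obtain ⟨n, hn⟩ := h
  rw [← map_pow, Ideal.Quotient.eq_zero_iff_mem] at hn
  refine ⟨n * m, ?_⟩
  rw [pow_mul, ← Ideal.mem_bot, ← Ideal.zero_eq_bot, ← hm]
  exact Ideal.pow_mem_pow hn m

theorem isIntegral_of_isNilpotent_sub {a : A} {c : k} (h : IsNilpotent (a - algebraMap k A c)) :
    IsIntegral k a := by
  obtain ⟨n, hn⟩ := h
  have isIntegral_sub : IsIntegral k (a - algebraMap k A c) := by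
    refine IsIntegral.of_pow n.succ_pos ?_
    rw [pow_succ, hn, zero_mul]
    exact isIntegral_zero
  simpa only [sub_add_cancel] using isIntegral_sub.add (isIntegral_algebraMap (x := c))

theorem exists_finite_subalgebra_map_eq {N : Ideal A} (hN : IsNilpotent N) (B₁ : Subalgebra k A)
    [Module.Finite k B₁] (B₀ : Subalgebra k (A ⧸ N)) [Module.Finite k B₀]
    (h₀ : ∀ b ∈ B₀, ∃ c : k, IsNilpotent (b - algebraMap k (A ⧸ N) c))
    (hle : B₁.map (Ideal.Quotient.mkₐ k N) ≤ B₀) :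
    ∃ B : Subalgebra k A, B₁ ≤ B ∧ Module.Finite k B ∧ B.map (Ideal.Quotient.mkₐ k N) = B₀ ∧
      ∀ b ∈ B, ∃ c : k, IsNilpotent (b - algebraMap k A c) := by
  have isNilpotent_sub (a) (ha : Ideal.Quotient.mk N a ∈ B₀) :
      ∃ c : k, IsNilpotent (a - algebraMap k A c) :=
    (h₀ _ ha).imp fun c hc => isNilpotent_of_isNilpotent_mk hN (by rwa [map_sub])
  obtain ⟨t, ht⟩ := (Module.Finite.iff_fg (N := B₀.toSubmodule)).1 ‹_›
  choose r hr using Ideal.Quotient.mk_surjective (I := N)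
  have mk_mem : ∀ a ∈ r '' t, Ideal.Quotient.mk N a ∈ B₀ := by
    rintro _ ⟨y, hy, rfl⟩
    exact (hr y).symm ▸ ht.le (Submodule.subset_span hy)
  have : Module.Finite k (Algebra.adjoin k (r '' t)) :=
    Module.Finite.iff_fg.2 <| fg_adjoin_of_finite (t.finite_toSet.image r) fun a ha =>
      (isNilpotent_sub a (mk_mem a ha)).elim fun _ => isIntegral_of_isNilpotent_sub
  let B := B₁ ⊔ Algebra.adjoin k (r '' t)
  have map_le : B.map (Ideal.Quotient.mkₐ k N) ≤ B₀ :=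
    Subalgebra.map_le.2 (sup_le (Subalgebra.map_le.1 hle) (Algebra.adjoin_le mk_mem))
  have le_map : B₀.toSubmodule ≤ (B.map (Ideal.Quotient.mkₐ k N)).toSubmodule := by
    rw [← ht, Submodule.span_le]
    exact fun y hy => ⟨r y, (le_sup_right : _ ≤ B) (Algebra.subset_adjoin ⟨y, hy, rfl⟩), hr y⟩
  exact ⟨B, le_sup_left, Subalgebra.finite_sup _ _, map_le.antisymm le_map,
    fun b hb => isNilpotent_sub b (map_le ⟨b, hb, rfl⟩)⟩

end LocalAlgebra

/-! ### Formal submersions and lifting properties -/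

namespace FunAlg

variable {k : Type u} [Field k] {C D : CoCom k}

theorem map_comp {E : CoCom k} (f : C ⟶ D) (g : D ⟶ E) : map (f ≫ g) = (map f).comp (map g) := rfl

theorem exists_maxIdeal_pow_le_ker_map (f : C ⟶ D) [Module.Finite k C.carrier] :
    ∃ n, maxIdeal D ^ n ≤ RingHom.ker (map f) :=
  (exists_maxIdeal_pow_eq_bot C).imp fun n hn =>
    (maxIdeal_pow_le_comap f n).trans (Ideal.comap_mono hn.le)

theorem isNilpotent_ker_map (f : C ⟶ D) [Module.Finite k D.carrier] :
    IsNilpotent (RingHom.ker (map f)) := by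
  have ker_le : RingHom.ker (map f) ≤ maxIdeal D := fun φ hφ => by
    rw [mem_maxIdeal, ← CoCom.Hom.map_pt f, ← map_apply, RingHom.mem_ker.1 hφ]
    rfl
  exact (exists_maxIdeal_pow_eq_bot D).imp fun n hn =>
    le_bot_iff.1 ((Ideal.pow_right_mono ker_le n).trans hn.le)

variable {B : Type u} [CommRing B] [Algebra k B] (γ : FunAlg C →ₐ[k] B)
  (hγ : ∃ n, maxIdeal C ^ n ≤ RingHom.ker γ)

include hγ

theorem finite_range_of_continuous : Module.Finite k γ.range := by
  obtain ⟨n, hn⟩ := hγ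
  obtain ⟨E, hE, mem_pow⟩ := exists_finite_forall_mem_maxIdeal_pow C n
  obtain ⟨p, hp⟩ := E.subtype.exists_leftInverse_of_injective E.ker_subtype
  let L : Module.Dual k E →ₗ[k] B :=
    γ.toLinearMap ∘ₗ (WithConv.linearEquiv k _).symm.toLinearMap ∘ₗ p.dualMap
  have range_le : γ.range.toSubmodule ≤ LinearMap.range L := by
    rintro _ ⟨φ, rfl⟩
    refine ⟨φ.ofConv ∘ₗ E.subtype, sub_eq_zero.1 ?_⟩
    refine Eq.trans (map_sub γ _ _).symm (hn (mem_pow _ fun y hy => ?_))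
    have p_apply : p y = ⟨y, hy⟩ := LinearMap.congr_fun hp ⟨y, hy⟩
    change φ (p y) - φ y = 0
    rw [p_apply, sub_self]
  exact Submodule.finiteDimensional_of_le range_le

theorem exists_isNilpotent_sub_of_mem_range :
    ∀ b ∈ γ.range, ∃ c : k, IsNilpotent (b - algebraMap k B c) := by
  rintro _ ⟨φ, rfl⟩
  obtain ⟨n, hn⟩ := hγ
  have sub_mem : φ - algebraMap k _ (φ C.pt) ∈ maxIdeal C := by
    rw [mem_maxIdeal, WithConv.ofConv_sub, LinearMap.sub_apply, LinearMap.convAlgebraMap_apply,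
      C.isConilpotent.isGroupLike.counit_eq_one]
    simp
  refine ⟨φ C.pt, n, ?_⟩
  have pow_eq_zero := hn (Ideal.pow_mem_pow sub_mem n)
  rwa [RingHom.mem_ker, map_pow, map_sub, AlgHom.commutes] at pow_eq_zero

theorem exists_dualCo_hom [Module.Finite k B] (aug : B →ₐ[k] k)
    (h : IsNilpotent (RingHom.ker aug)) :
    ∃ w : dualCo aug h ⟶ C, ∀ φ, map w φ = funAlgDualCo aug h (γ φ) := by
  obtain ⟨w, hw⟩ := exists_map_eq ((funAlgDualCo aug h).toAlgHom.comp γ)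
    (exists_pow_le_ker_comp hγ ((funAlgDualCo aug h).toAlgHom : B →+* FunAlg (dualCo aug h)))
  exact ⟨w, RingHom.congr_fun hw⟩

end FunAlg

section LiftingProperty

variable {k : Type u} [Field k] {C D : CoCom k} {f : C ⟶ D}

/-- The injective morphisms with finite-dimensional target: formal submersions are characterized by
the right lifting property against them. -/
def finiteInjections (k : Type u) [Field k] : MorphismProperty (CoCom k) :=
  fun _ Y i => Function.Injective i.hom ∧ Module.Finite k Y.carrier

theorem IsFormalSubmersion.rlp (hf : IsFormalSubmersion f) : (finiteInjections k).rlp f := by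
  rintro X₀ X i ⟨hi, hX⟩
  refine ⟨fun {u v} sq => ?_⟩
  have : Module.Finite k X₀.carrier :=
    Module.Finite.of_injective (i.hom : X₀.carrier →ₗ[k] X.carrier) hi
  obtain ⟨γ, hγ, γ_comp, comp_γ⟩ := hf.hasContinuousLifts (FunAlg.map_surjective hi)
    (FunAlg.isNilpotent_ker_map i) (FunAlg.map v) (FunAlg.map u)
    (FunAlg.exists_maxIdeal_pow_le_ker_map v) (FunAlg.exists_maxIdeal_pow_le_ker_map u)
    (by rw [← FunAlg.map_comp, ← FunAlg.map_comp, sq.w])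
  let γ' : FunAlg C →ₐ[k] FunAlg X := { γ with
    commutes' := fun c => by
      rw [← FunAlg.map_algebraMap v, ← γ_comp, RingHom.comp_apply, FunAlg.map_algebraMap]
      rfl }
  obtain ⟨w, hw⟩ := FunAlg.exists_map_eq γ' hγ
  refine ⟨⟨⟨w, FunAlg.hom_eq_of_map_eq ?_, FunAlg.hom_eq_of_map_eq ?_⟩⟩⟩
  · rw [FunAlg.map_comp, hw]
    exact comp_γ
  · rw [FunAlg.map_comp, hw]
    exact γ_comp

/-- The dual coalgebras turn the lifting problem into one of `f` against an injective morphism. -/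
theorem exists_lift_of_rlp (hf : (finiteInjections k).rlp f) {B B₀ : Type u} [CommRing B]
    [Algebra k B] [Module.Finite k B] [CommRing B₀] [Algebra k B₀] [Module.Finite k B₀]
    {aug : B →ₐ[k] k} (haug : IsNilpotent (RingHom.ker aug)) {aug₀ : B₀ →ₐ[k] k}
    (haug₀ : IsNilpotent (RingHom.ker aug₀)) {q : B →ₐ[k] B₀} (hq : Function.Surjective q)
    {α : FunAlg D →ₐ[k] B} (hα : ∃ n, FunAlg.maxIdeal D ^ n ≤ RingHom.ker α)
    {β : FunAlg C →ₐ[k] B₀} (hβ : ∃ n, FunAlg.maxIdeal C ^ n ≤ RingHom.ker β)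
    (comm : ∀ φ, q (α φ) = β (FunAlg.map f φ)) :
    ∃ γ : FunAlg C →+* B, (∃ n, FunAlg.maxIdeal C ^ n ≤ RingHom.ker γ) ∧
      (∀ φ, γ (FunAlg.map f φ) = α φ) ∧ ∀ φ, q (γ φ) = β φ := by
  let e := funAlgDualCo aug haug
  let e₀ := funAlgDualCo aug₀ haug₀
  obtain ⟨u, hu⟩ := FunAlg.exists_dualCo_hom β hβ aug₀ haug₀
  obtain ⟨v, hv⟩ := FunAlg.exists_dualCo_hom α hα aug haug
  obtain ⟨i, hi⟩ := FunAlg.exists_dualCo_hom (q.comp e.symm.toAlgHom)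
    ((FunAlg.exists_maxIdeal_pow_eq_bot (dualCo aug haug)).imp fun _ hn => hn.trans_le bot_le)
    aug₀ haug₀
  have map_i (b) : FunAlg.map i (e b) = e₀ (q b) :=
    (hi (e b)).trans (congrArg (e₀ <| q ·) (e.symm_apply_apply b))
  have injective_i : Function.Injective i.hom := FunAlg.injective_of_map_surjective fun φ => by
    obtain ⟨b₀, rfl⟩ := e₀.surjective φ
    obtain ⟨b, rfl⟩ := hq b₀
    exact ⟨e b, map_i b⟩
  have sq : CommSq u i f v := ⟨FunAlg.hom_eq_of_map_eq <| RingHom.ext fun φ =>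
    (hu _).trans <| (congrArg e₀ (comm φ).symm).trans <|
      (map_i _).symm.trans (congrArg (FunAlg.map i) (hv φ).symm)⟩
  have := hf i ⟨injective_i, inferInstance⟩
  have map_lift (φ) : FunAlg.map sq.lift (FunAlg.map f φ) = FunAlg.map v φ :=
    RingHom.congr_fun (congrArg FunAlg.map sq.fac_right) φ
  have map_map_lift (φ) : FunAlg.map i (FunAlg.map sq.lift φ) = FunAlg.map u φ :=
    RingHom.congr_fun (congrArg FunAlg.map sq.fac_left) φ
  refine ⟨(e.symm : FunAlg (dualCo aug haug) →+* B).comp (FunAlg.map sq.lift),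
    exists_pow_le_ker_comp (FunAlg.exists_maxIdeal_pow_le_ker_map sq.lift) _, fun φ => ?_,
    fun φ => e₀.injective ?_⟩
  · exact (congrArg e.symm ((map_lift φ).trans (hv φ))).trans (e.symm_apply_apply _)
  · rw [← hu, ← map_map_lift, ← map_i]
    exact congrArg (FunAlg.map i) (e.apply_symm_apply (FunAlg.map sq.lift φ))

theorem exists_lift_quotient_of_rlp (hf : (finiteInjections k).rlp f) {A : Type u} [CommRing A]
    [Algebra k A] [Nontrivial A] {N : Ideal A} (hN : IsNilpotent N)
    {α : FunAlg D →ₐ[k] A} (hα : ∃ n, FunAlg.maxIdeal D ^ n ≤ RingHom.ker α)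
    {β : FunAlg C →ₐ[k] A ⧸ N} (hβ : ∃ n, FunAlg.maxIdeal C ^ n ≤ RingHom.ker β)
    (comm : ∀ φ, Ideal.Quotient.mk N (α φ) = β (FunAlg.map f φ)) :
    ∃ γ : FunAlg C →+* A, (∃ n, FunAlg.maxIdeal C ^ n ≤ RingHom.ker γ) ∧
      (∀ φ, γ (FunAlg.map f φ) = α φ) ∧ ∀ φ, Ideal.Quotient.mk N (γ φ) = β φ := by
  have : Nontrivial (A ⧸ N) := Ideal.Quotient.nontrivial_iff.2 fun eq_top => by
    obtain ⟨n, hn⟩ := hN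
    rw [eq_top, Ideal.top_pow] at hn
    exact top_ne_bot hn
  have := FunAlg.finite_range_of_continuous α hα
  have := FunAlg.finite_range_of_continuous β hβ
  have exists_sub := FunAlg.exists_isNilpotent_sub_of_mem_range β hβ
  obtain ⟨B, range_le, hB, map_eq, hBn⟩ := exists_finite_subalgebra_map_eq hN α.range β.range
    exists_sub <| Subalgebra.map_le.2 <| by
      rintro _ ⟨φ, rfl⟩
      exact ⟨FunAlg.map f φ, (comm φ).symm⟩
  obtain ⟨aug, haug⟩ := exists_algHom_isNilpotent_ker_subalgebra B hBn
  obtain ⟨aug₀, haug₀⟩ := exists_algHom_isNilpotent_ker_subalgebra β.range exists_sub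
  let α' : FunAlg D →ₐ[k] B := α.codRestrict B fun φ => range_le ⟨φ, rfl⟩
  let q : B →ₐ[k] β.range := ((Ideal.Quotient.mkₐ k N).comp B.val).codRestrict β.range
    fun b => map_eq.le ⟨b, b.2, rfl⟩
  have hq : Function.Surjective q := fun ⟨y, hy⟩ =>
    let ⟨b, hb, h⟩ := map_eq.ge hy
    ⟨⟨b, hb⟩, Subtype.ext h⟩
  obtain ⟨γ, hγ, γ_map, q_γ⟩ := exists_lift_of_rlp hf haug haug₀ hq (α := α')
    (hα.imp fun _ hn φ hφ => Subtype.ext (hn hφ)) (β := β.rangeRestrict)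
    (hβ.imp fun _ hn φ hφ => Subtype.ext (hn hφ)) (fun φ => Subtype.ext (comm φ))
  exact ⟨(B.val : B →+* A).comp γ, exists_pow_le_ker_comp hγ _,
    fun φ => congrArg Subtype.val (γ_map φ), fun φ => congrArg Subtype.val (q_γ φ)⟩

theorem isFormalSubmersion_of_rlp (hf : (finiteInjections k).rlp f) : IsFormalSubmersion f := by
  intro A _ N hN α β hα hβ comm
  rcases subsingleton_or_nontrivial A with hA | hA
  · exact hasContinuousLifts_ringEquiv
      (RingEquiv.ofBijective (Ideal.Quotient.mk N) ⟨Function.injective_of_subsingleton _,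
        Ideal.Quotient.mk_surjective⟩) α β hα hβ comm
  let : Algebra k A := (α.comp (algebraMap k (FunAlg D))).toAlgebra
  let α' : FunAlg D →ₐ[k] A := { α with commutes' := fun _ => rfl }
  let β' : FunAlg C →ₐ[k] A ⧸ N := { β with
    commutes' := fun c => by
      have comm_c := RingHom.congr_fun comm (algebraMap k _ c)
      rw [RingHom.comp_apply β, FunAlg.map_algebraMap] at comm_c
      exact comm_c.symm }
  obtain ⟨γ, hγ, γ_map, mk_γ⟩ := exists_lift_quotient_of_rlp hf ⟨2, hN⟩ (α := α') hα (β := β') hβ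
    (RingHom.congr_fun comm)
  exact ⟨γ, hγ, RingHom.ext γ_map, RingHom.ext mk_γ⟩

theorem formalSubmersions_eq_rlp : formalSubmersions k = (finiteInjections k).rlp :=
  MorphismProperty.ext _ _ fun _ _ _ => ⟨IsFormalSubmersion.rlp, isFormalSubmersion_of_rlp⟩

end LiftingProperty

/-! ### Finite limits -/

section IsCofree

variable {k V : Type u} [Field k] [AddCommGroup V] [Module k V] {S C : CoCom k}
  {π : S.carrier →ₗ[k] V}

theorem IsCofree.hom_ext (h : IsCofree S π) {f g : C ⟶ S}
    (hfg : ∀ x, π (f.hom x) = π (g.hom x)) : f = g := by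
  have π_map_pt : π (g.hom C.pt) = 0 := by rw [CoCom.Hom.map_pt, h.map_pt]
  exact CoCom.Hom.ext ((h.existsUnique_lift C.carrier C.pt C.isConilpotent
    (π ∘ₗ (g.hom : C.carrier →ₗ[k] S.carrier)) π_map_pt).unique (LinearMap.ext hfg) rfl)

theorem IsCofree.exists_hom (h : IsCofree S π) {φ : C.carrier →ₗ[k] V} (hφ : φ C.pt = 0) :
    ∃ f : C ⟶ S, ∀ x, π (f.hom x) = φ x := by
  obtain ⟨F, hF, -⟩ := h.existsUnique_lift C.carrier C.pt C.isConilpotent φ hφ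
  exact ⟨⟨F⟩, LinearMap.congr_fun hF⟩

theorem IsCofree.hasLimit_pair {V' : Type u} [AddCommGroup V'] [Module k V'] {S' P : CoCom k}
    {π' : S'.carrier →ₗ[k] V'} {ρ : P.carrier →ₗ[k] V × V'} (h : IsCofree S π)
    (h' : IsCofree S' π') (hρ : IsCofree P ρ) : HasLimit (pair S S') := by
  obtain ⟨p, hp⟩ := h.exists_hom (φ := LinearMap.fst k V V' ∘ₗ ρ) (congrArg Prod.fst hρ.map_pt)
  obtain ⟨p', hp'⟩ := h'.exists_hom (φ := LinearMap.snd k V V' ∘ₗ ρ) (congrArg Prod.snd hρ.map_pt)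
  have exists_lift {T : CoCom k} (f : T ⟶ S) (g : T ⟶ S') :
      ∃ l : T ⟶ P, l ≫ p = f ∧ l ≫ p' = g := by
    obtain ⟨l, hl⟩ := hρ.exists_hom
      (φ := (π ∘ₗ (f.hom : T.carrier →ₗ[k] S.carrier)).prod
        (π' ∘ₗ (g.hom : T.carrier →ₗ[k] S'.carrier)))
      (Prod.ext ((congrArg π (CoCom.Hom.map_pt f)).trans h.map_pt)
        ((congrArg π' (CoCom.Hom.map_pt g)).trans h'.map_pt))
    exact ⟨l, h.hom_ext fun x => (hp _).trans (congrArg Prod.fst (hl x)),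
      h'.hom_ext fun x => (hp' _).trans (congrArg Prod.snd (hl x))⟩
  choose l hl hl' using @exists_lift
  refine ⟨⟨BinaryFan.mk p p', BinaryFan.IsLimit.mk _ l hl hl' ?_⟩⟩
  rintro T _ _ m rfl rfl
  refine hρ.hom_ext fun x => Prod.ext ?_ ?_
  · exact (hp _).symm.trans
      ((congrArg (fun q : T ⟶ S => π (q.hom x)) (hl (m ≫ p) (m ≫ p')).symm).trans (hp _))
  · exact (hp' _).symm.trans
      ((congrArg (fun q : T ⟶ S' => π' (q.hom x)) (hl' (m ≫ p) (m ≫ p')).symm).trans (hp' _))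

end IsCofree

namespace CoCom

variable {k : Type u} [Field k] {C C' D T : CoCom k}

theorem mono_of_injective {f : C ⟶ D} (hf : Function.Injective f.hom) : Mono f :=
  ⟨fun _ _ h => hom_ext fun x => hf (congrArg (fun m : _ ⟶ D => m.hom x) h)⟩

theorem exists_comp_subι_eq {E : Submodule k C.carrier} (hpt : C.pt ∈ E) (g : T ⟶ C)
    (h : ∀ x, g.hom x ∈ E) :
    ∃ g', g' ≫ C.subι (largestSubcoalgebra E) (isSubcoalgebra_largestSubcoalgebra E)
      (pt_mem_largestSubcoalgebra hpt) = g :=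
  exists_comp_eq_of_injective (subι_injective _ _ _) g
    ((range_le_largestSubcoalgebra g h).trans (range_subι _ _ _).ge)

theorem hasLimit_parallelPair (f g : C ⟶ D) : HasLimit (parallelPair f g) := by
  let E := LinearMap.eqLocus (f.hom : C.carrier →ₗ[k] D.carrier) g.hom
  have hpt : C.pt ∈ E := (Hom.map_pt f).trans (Hom.map_pt g).symm
  let ι := C.subι _ (isSubcoalgebra_largestSubcoalgebra E) (pt_mem_largestSubcoalgebra hpt)
  have : Mono ι := mono_of_injective (subι_injective _ _ _)
  have condition : ι ≫ f = ι ≫ g :=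
    hom_ext fun x => largestSubcoalgebra_le E (C.subι_mem _ _ _ x)
  refine ⟨⟨Fork.ofι ι condition, Fork.IsLimit.ofExistsUnique fun s => ?_⟩⟩
  obtain ⟨l, hl⟩ := exists_comp_subι_eq hpt s.ι fun x =>
    congrArg (fun m : s.pt ⟶ D => m.hom x) s.condition
  exact ⟨l, hl, fun m hm => (cancel_mono ι).1 (hm.trans hl.symm)⟩

theorem hasLimit_pair_of_injective {S S' : CoCom k} [HasLimit (pair S S')] {i : C ⟶ S}
    (hi : Function.Injective i.hom) {i' : C' ⟶ S'} (hi' : Function.Injective i'.hom) :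
    HasLimit (pair C C') := by
  let P := prod S S'
  let p : P ⟶ S := prod.fst
  let p' : P ⟶ S' := prod.snd
  let E : Submodule k P.carrier :=
    (LinearMap.range (i.hom : C.carrier →ₗ[k] S.carrier)).comap
        (p.hom : P.carrier →ₗ[k] S.carrier) ⊓
      (LinearMap.range (i'.hom : C'.carrier →ₗ[k] S'.carrier)).comap
        (p'.hom : P.carrier →ₗ[k] S'.carrier)
  have hpt : P.pt ∈ E := ⟨⟨C.pt, (Hom.map_pt i).trans (Hom.map_pt p).symm⟩,
    C'.pt, (Hom.map_pt i').trans (Hom.map_pt p').symm⟩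
  let ι := P.subι _ (isSubcoalgebra_largestSubcoalgebra E) (pt_mem_largestSubcoalgebra hpt)
  have ι_mem (x) : ι.hom x ∈ E := largestSubcoalgebra_le E (P.subι_mem _ _ _ x)
  have := mono_of_injective hi
  have := mono_of_injective hi'
  have : Mono ι := mono_of_injective (subι_injective _ _ _)
  obtain ⟨a, ha⟩ := exists_comp_eq_of_injective hi (ι ≫ p) <| by
    rintro _ ⟨x, rfl⟩
    exact (ι_mem x).1
  obtain ⟨b, hb⟩ := exists_comp_eq_of_injective hi' (ι ≫ p') <| by
    rintro _ ⟨x, rfl⟩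
    exact (ι_mem x).2
  have exists_lift {T : CoCom k} (f : T ⟶ C) (g : T ⟶ C') : ∃ l, l ≫ a = f ∧ l ≫ b = g := by
    have lift_fst : prod.lift (f ≫ i) (g ≫ i') ≫ p = f ≫ i := prod.lift_fst _ _
    have lift_snd : prod.lift (f ≫ i) (g ≫ i') ≫ p' = g ≫ i' := prod.lift_snd _ _
    obtain ⟨l, hl⟩ := exists_comp_subι_eq hpt (prod.lift (f ≫ i) (g ≫ i')) fun x =>
      ⟨⟨f.hom x, congrArg (fun m : T ⟶ S => m.hom x) lift_fst.symm⟩,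
        g.hom x, congrArg (fun m : T ⟶ S' => m.hom x) lift_snd.symm⟩
    refine ⟨l, (cancel_mono i).1 ?_, (cancel_mono i').1 ?_⟩
    · rw [Category.assoc, ha, ← Category.assoc, hl, lift_fst]
    · rw [Category.assoc, hb, ← Category.assoc, hl, lift_snd]
  choose l hl hl' using @exists_lift
  refine ⟨⟨BinaryFan.mk a b, BinaryFan.IsLimit.mk _ l hl hl' ?_⟩⟩
  rintro T _ _ m rfl rfl
  refine (cancel_mono ι).1 (prod.hom_ext ?_ ?_)
  · change (m ≫ ι) ≫ p = (l (m ≫ a) (m ≫ b) ≫ ι) ≫ p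
    rw [Category.assoc, Category.assoc, ← ha, ← Category.assoc, ← Category.assoc, hl]
  · change (m ≫ ι) ≫ p' = (l (m ≫ a) (m ≫ b) ≫ ι) ≫ p'
    rw [Category.assoc, Category.assoc, ← hb, ← Category.assoc, ← Category.assoc, hl']

/-- The ground field is terminal. -/
def groundIsTerminal : IsTerminal (ground k) :=
  IsTerminal.ofUniqueHom counit fun _ m => hom_ext fun x => CoalgHomClass.counit_comp_apply m.hom x

theorem injective_of_proj_eq [CharZero k] [Module.Finite k (Prim C)] {F : C ⟶ symCo k (Prim C)}
    (hF : ∀ x : Prim C, symCo.proj k (Prim C) (F.hom x) = x) : Function.Injective F.hom :=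
  injective_of_prim_map_injective (Function.LeftInverse.injective
    (g := fun y : Prim (symCo k (Prim C)) => symCo.proj k (Prim C) y) hF)

theorem exists_injective_symCo [CharZero k] (C : CoCom k) [Module.Finite k (Prim C)] :
    ∃ F : C ⟶ symCo k (Prim C), Function.Injective F.hom := by
  obtain ⟨ℓ, hℓ, ℓ_pt⟩ := exists_extend_prim (C := C) LinearMap.id
  obtain ⟨F, hF⟩ := isCofree_symCo.exists_hom ℓ_pt
  exact ⟨F, injective_of_proj_eq fun x => (hF x).trans (hℓ x)⟩

theorem hasFiniteLimits [CharZero k] : HasFiniteLimits (CoCom k) := by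
  have hasLimit_pair (C C' : CoCom k) : HasLimit (pair C C') := by
    have := C.finiteType
    have := C'.finiteType
    obtain ⟨i, hi⟩ := exists_injective_symCo C
    obtain ⟨i', hi'⟩ := exists_injective_symCo C'
    have := isCofree_symCo.hasLimit_pair isCofree_symCo
      (isCofree_symCo (k := k) (V := Prim C × Prim C'))
    exact hasLimit_pair_of_injective hi hi'
  have : HasBinaryProducts (CoCom k) := hasBinaryProducts_of_hasLimit_pair _
  have : HasTerminal (CoCom k) := groundIsTerminal.hasTerminal
  have : HasFiniteProducts (CoCom k) := hasFiniteProducts_of_has_binary_and_terminal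
  have : HasEqualizers (CoCom k) :=
    @hasEqualizers_of_hasLimit_parallelPair _ _ fun {_ _ f g} => hasLimit_parallelPair f g
  exact hasFiniteLimits_of_hasEqualizers_and_finite_products

end CoCom

/-! ### Sections of formal submersions -/

section Sections

variable {k : Type u} [Field k] {C D : CoCom k} {f : C ⟶ D}

theorem exists_compatible_lift (hf : (finiteInjections k).rlp f) {S T : CoCom k}
    [Module.Finite k T.carrier] {u : S ⟶ C} (hu : Function.Injective (u ≫ f).hom) {j : T ⟶ D}
    (hj : Function.Injective j.hom) :
    ∃ s : T ⟶ C, s ≫ f = j ∧ ∀ x y, (u ≫ f).hom x = j.hom y → s.hom y = u.hom x := by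
  let W := (LinearMap.range (j.hom : T.carrier →ₗ[k] D.carrier)).comap
    ((u ≫ f).hom : S.carrier →ₗ[k] D.carrier)
  let ι := S.subι W ((isSubcoalgebra_range j.hom).comap hu)
    ⟨T.pt, (CoCom.Hom.map_pt j).trans (CoCom.Hom.map_pt (u ≫ f)).symm⟩
  obtain ⟨i, hi⟩ := CoCom.exists_comp_eq_of_injective hj (ι ≫ u ≫ f) <| by
    rintro _ ⟨x, rfl⟩
    exact x.2
  have j_i (x) : j.hom (i.hom x) = (u ≫ f).hom (ι.hom x) :=
    congrArg (fun m : _ ⟶ D => m.hom x) hi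
  have injective_i : Function.Injective i.hom := fun x y hxy =>
    CoCom.subι_injective _ _ _ (hu (by rw [← j_i, hxy, j_i]))
  have sq : CommSq (ι ≫ u) i f j := ⟨hi.symm⟩
  have := hf i ⟨injective_i, ‹_›⟩
  refine ⟨sq.lift, sq.fac_right, fun x y hxy => ?_⟩
  let x' : W := ⟨x, y, hxy.symm⟩
  have i_x' : i.hom x' = y := hj ((j_i x').trans hxy)
  rw [← i_x']
  exact congrArg (fun m : _ ⟶ C => m.hom x') sq.fac_left

theorem CoCom.injective_subι_comp {W : Submodule k C.carrier} (hW : IsSubcoalgebra k W)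
    (hpt : C.pt ∈ W)
    (disjoint : Disjoint W (LinearMap.ker (f.hom : C.carrier →ₗ[k] D.carrier))) :
    Function.Injective (C.subι W hW hpt ≫ f).hom :=
  (injective_iff_map_eq_zero (C.subι W hW hpt ≫ f).hom).2 fun w hw =>
    Subtype.ext (LinearMap.disjoint_ker.1 disjoint _ (C.subι_mem W hW hpt w) hw)

theorem exists_isSubcoalgebra_disjoint_ker_le_map (hf : (finiteInjections k).rlp f)
    {W : Submodule k C.carrier} (hW : IsSubcoalgebra k W) (hpt : C.pt ∈ W)
    (disjoint : Disjoint W (LinearMap.ker (f.hom : C.carrier →ₗ[k] D.carrier)))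
    {E : Submodule k D.carrier} [Module.Finite k E] (hE : IsSubcoalgebra k E) (hpt' : D.pt ∈ E) :
    ∃ W' ≥ W, IsSubcoalgebra k W' ∧
      Disjoint W' (LinearMap.ker (f.hom : C.carrier →ₗ[k] D.carrier)) ∧
      E ≤ W'.map (f.hom : C.carrier →ₗ[k] D.carrier) := by
  have : Module.Finite k (D.sub E hE hpt').carrier := ‹Module.Finite k E›
  obtain ⟨s, hs, s_eq⟩ := exists_compatible_lift hf (CoCom.injective_subι_comp hW hpt disjoint)
    (D.subι_injective E hE hpt')
  have f_s (e) : f.hom (s.hom e) = (D.subι E hE hpt').hom e :=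
    congrArg (fun m : D.sub E hE hpt' ⟶ D => m.hom e) hs
  refine ⟨W ⊔ LinearMap.range (s.hom : (D.sub E hE hpt').carrier →ₗ[k] C.carrier), le_sup_left,
    hW.sup (isSubcoalgebra_range s.hom), LinearMap.disjoint_ker.2 fun x hx hfx => ?_,
    fun e he => ⟨_, Submodule.mem_sup_right ⟨⟨e, he⟩, rfl⟩, f_s ⟨e, he⟩⟩⟩
  obtain ⟨w, hw, _, ⟨e, rfl⟩, rfl⟩ := Submodule.mem_sup.1 hx
  have f_neg : f.hom (-w) = (D.subι E hE hpt').hom e := by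
    rw [← f_s, map_neg, neg_eq_iff_add_eq_zero]
    exact (map_add f.hom _ _).symm.trans hfx
  exact add_eq_zero_iff_eq_neg'.2 (s_eq ⟨-w, W.neg_mem hw⟩ e f_neg)

theorem exists_isSubcoalgebra_disjoint_ker_map_eq_top (hf : (finiteInjections k).rlp f)
    {W₀ : Submodule k C.carrier} (hW₀ : IsSubcoalgebra k W₀) (hpt : C.pt ∈ W₀)
    (disjoint₀ : Disjoint W₀ (LinearMap.ker (f.hom : C.carrier →ₗ[k] D.carrier))) :
    ∃ W ≥ W₀, IsSubcoalgebra k W ∧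
      Disjoint W (LinearMap.ker (f.hom : C.carrier →ₗ[k] D.carrier)) ∧
      W.map (f.hom : C.carrier →ₗ[k] D.carrier) = ⊤ := by
  obtain ⟨W, hle, hmax⟩ := zorn_le_nonempty₀
    {W | IsSubcoalgebra k W ∧ Disjoint W (LinearMap.ker (f.hom : C.carrier →ₗ[k] D.carrier))}
    (fun c hc chain W hW => by
      refine ⟨sSup c, ⟨isSubcoalgebra_sSup fun V hV => (hc hV).1,
        LinearMap.disjoint_ker.2 fun x hx hfx => ?_⟩, fun V => le_sSup⟩
      obtain ⟨V, hV, hxV⟩ := (Submodule.mem_sSup_of_directed ⟨W, hW⟩ chain.directedOn).1 hx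
      exact LinearMap.disjoint_ker.1 (hc hV).2 x hxV hfx) W₀ ⟨hW₀, disjoint₀⟩
  refine ⟨W, hle, hmax.prop.1, hmax.prop.2, eq_top_iff.2 fun x _ => ?_⟩
  obtain ⟨n, hn⟩ := D.isConilpotent.exhaustive x
  have := D.finiteType
  have := finite_primFiltration (k := k) (e := D.pt) n
  have isGroupLike := D.isConilpotent.isGroupLike
  obtain ⟨W', hle', hW', disjoint', le_map⟩ := exists_isSubcoalgebra_disjoint_ker_le_map hf
    hmax.prop.1 (hle hpt) hmax.prop.2 (isSubcoalgebra_primFiltration isGroupLike n)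
    (self_mem_primFiltration isGroupLike n)
  exact Submodule.map_mono (hmax.le_of_ge ⟨hW', disjoint'⟩ hle') (le_map hn)

theorem exists_section_comp_eq (hf : (finiteInjections k).rlp f) {S : CoCom k} {u : S ⟶ C}
    (hu : Function.Injective (u ≫ f).hom) :
    ∃ s : D ⟶ C, s ≫ f = 𝟙 D ∧ (u ≫ f) ≫ s = u := by
  obtain ⟨W, range_le, hW, disjoint, map_eq_top⟩ := exists_isSubcoalgebra_disjoint_ker_map_eq_top hf
    (isSubcoalgebra_range u.hom) ⟨S.pt, CoCom.Hom.map_pt u⟩ <| LinearMap.disjoint_ker.2 <| by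
      rintro _ ⟨x, rfl⟩ hx
      have x_eq_zero : x = 0 := hu (hx.trans (map_zero (u ≫ f).hom).symm)
      rw [x_eq_zero, map_zero]
  have hpt : C.pt ∈ W := range_le ⟨S.pt, CoCom.Hom.map_pt u⟩
  let ι := C.subι W hW hpt
  have : IsIso (ι ≫ f) := CoCom.isIso_of_bijective
    ⟨CoCom.injective_subι_comp hW hpt disjoint, fun y => by
      obtain ⟨w, hw, hwy⟩ := map_eq_top.ge (Submodule.mem_top (x := y))
      exact ⟨⟨w, hw⟩, hwy⟩⟩
  obtain ⟨u', rfl⟩ := CoCom.exists_comp_eq_of_injective (C.subι_injective W hW hpt) u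
    (range_le.trans (C.range_subι W hW hpt).ge)
  exact ⟨inv (ι ≫ f) ≫ ι, by rw [Category.assoc, IsIso.inv_hom_id],
    by rw [Category.assoc u', Category.assoc u', IsIso.hom_inv_id_assoc]⟩

end Sections

/-! ### The descent category -/

section Descent

variable {k : Type u} [Field k] {C D E : CoCom k} {f : C ⟶ D}

theorem IsFormalSubmersion.exists_section (hf : IsFormalSubmersion f) :
    ∃ s : D ⟶ C, s ≫ f = 𝟙 D := by
  have hpt : C.pt ∈ k ∙ C.pt := Submodule.mem_span_singleton_self _
  have disjoint : Disjoint (k ∙ C.pt) (LinearMap.ker (f.hom : C.carrier →ₗ[k] D.carrier)) :=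
    ((Submodule.disjoint_span_singleton' C.isConilpotent.isGroupLike.ne_zero).2 fun hmem =>
      D.isConilpotent.isGroupLike.ne_zero ((CoCom.Hom.map_pt f).symm.trans hmem)).symm
  obtain ⟨s, hs, -⟩ := exists_section_comp_eq hf.rlp (CoCom.injective_subι_comp
    (isSubcoalgebra_span_singleton C.isConilpotent.isGroupLike) hpt disjoint)
  exact ⟨s, hs⟩

theorem IsFormalSubmersion.prim_surjective (hf : IsFormalSubmersion f) :
    Function.Surjective (Prim.map f) := by
  obtain ⟨s, hs⟩ := hf.exists_section
  exact fun x => ⟨Prim.map s x, Subtype.ext (congrArg (fun m : D ⟶ D => m.hom x) hs)⟩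

theorem isEffectiveEpimorphism_of_section {𝒟 : Type*} [Category 𝒟] [HasPullbacks 𝒟] {X Y : 𝒟}
    {f : X ⟶ Y} {s : Y ⟶ X} (hs : s ≫ f = 𝟙 Y) : IsEffectiveEpimorphism f := by
  have h : IsKernelPair f (pullback.fst f f) (pullback.snd f f) := IsPullback.of_hasPullback f f
  have comm : (f ≫ s) ≫ f = 𝟙 X ≫ f := by
    rw [Category.assoc, hs, Category.comp_id, Category.id_comp]
  let split : IsSplitCoequalizer (pullback.fst f f) (pullback.snd f f) f :=
    { rightSection := s
      leftSection := h.lift (f ≫ s) (𝟙 X) comm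
      condition := h.w
      rightSection_π := hs
      leftSection_bottom := h.lift_snd _ _ comm
      leftSection_top := h.lift_fst _ _ comm }
  exact ⟨_, _, _, h, ⟨split.isCoequalizer⟩⟩

theorem IsFormalSubmersion.cancel_left {g : D ⟶ E} (hf : IsFormalSubmersion f)
    (hfg : IsFormalSubmersion (f ≫ g)) : IsFormalSubmersion g := by
  obtain ⟨s, hs⟩ := hf.exists_section
  have retract : RetractArrow g (f ≫ g) :=
    { i := Arrow.homMk s (𝟙 E) (by simp [reassoc_of% hs])
      r := Arrow.homMk f (𝟙 E) (by simp)
      retract := by ext <;> simp [hs] }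
  exact isFormalSubmersion_of_rlp ((finiteInjections k).rlp.of_retract retract hfg.rlp)

theorem isDescentCategory [CharZero k] :
    IsDescentCategory (CoCom k) (formalSubmersions k) where
  isMultiplicative := by rw [formalSubmersions_eq_rlp]; infer_instance
  hasFiniteLimits := CoCom.hasFiniteLimits
  terminal T _ := by
    rw [formalSubmersions_eq_rlp]
    exact MorphismProperty.id_mem _ T
  baseChange := by rw [formalSubmersions_eq_rlp]; infer_instance
  cancel _ _ := IsFormalSubmersion.cancel_left
  effective _ hf := by
    have := CoCom.hasFiniteLimits (k := k)
    obtain ⟨_, hs⟩ := IsFormalSubmersion.exists_section hf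
    exact isEffectiveEpimorphism_of_section hs

end Descent

/-! ### Formal manifolds -/

section Cofree

variable {k : Type u} [Field k] {V V' : Type u} [AddCommGroup V] [Module k V] [AddCommGroup V']
  [Module k V'] {C S S' : CoCom k} {π : S.carrier →ₗ[k] V} {π' : S'.carrier →ₗ[k] V'}

theorem IsCofree.of_iso (h : IsCofree S π) (e : C ≅ S) :
    IsCofree C (π ∘ₗ (e.hom.hom : C.carrier →ₗ[k] S.carrier)) where
  map_pt := (congrArg π (CoCom.Hom.map_pt e.hom)).trans h.map_pt
  existsUnique_lift D _ _ _ _ d hd φ hφ := by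
    obtain ⟨F, hF, huniq⟩ := h.existsUnique_lift D d hd φ hφ
    have hom_inv (x) : e.hom.hom (e.inv.hom x) = x :=
      congrArg (fun m : S ⟶ S => m.hom x) e.inv_hom_id
    have inv_hom (x) : e.inv.hom (e.hom.hom x) = x :=
      congrArg (fun m : C ⟶ C => m.hom x) e.hom_inv_id
    refine ⟨e.inv.hom.comp F, LinearMap.ext fun x => ?_, fun G hG => CoalgHom.ext fun x => ?_⟩
    · exact (congrArg π (hom_inv (F x))).trans (LinearMap.congr_fun hF x)
    · rw [← inv_hom (G x)]
      exact congrArg e.inv.hom (DFunLike.congr_fun (huniq (e.hom.hom.comp G) hG) x)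

theorem isCofree_ground :
    IsCofree (CoCom.ground k) (0 : (CoCom.ground k).carrier →ₗ[k] PUnit.{u + 1}) where
  map_pt := rfl
  existsUnique_lift D _ _ _ _ _ _ _ _ :=
    ⟨Coalgebra.counitCoalgHom k D, Subsingleton.elim _ _, fun F _ =>
      CoalgHom.ext fun x => CoalgHomClass.counit_comp_apply F x⟩

theorem IsCofree.isFormalSubmersion (h : IsCofree S π) (h' : IsCofree S' π') {p : V →ₗ[k] V'}
    (hp : Function.Surjective p) {g : S ⟶ S'} (comm : ∀ x, π' (g.hom x) = p (π x)) :
    IsFormalSubmersion g := by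
  refine isFormalSubmersion_of_rlp fun {T₀ T} i ⟨hi, _⟩ => ⟨fun {u v} sq => ?_⟩
  obtain ⟨ℓ, ℓ_i, p_ℓ⟩ := exists_linearMap_lift hi hp
    (π ∘ₗ (u.hom : T₀.carrier →ₗ[k] S.carrier)) (π' ∘ₗ (v.hom : T.carrier →ₗ[k] S'.carrier)) <|
      LinearMap.ext fun x => (comm _).symm.trans (congrArg (fun m : T₀ ⟶ S' => π' (m.hom x)) sq.w)
  have ℓ_pt : ℓ T.pt = 0 := by
    rw [← CoCom.Hom.map_pt i]
    exact (LinearMap.congr_fun ℓ_i T₀.pt).trans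
      ((congrArg π (CoCom.Hom.map_pt u)).trans h.map_pt)
  obtain ⟨w, hw⟩ := h.exists_hom ℓ_pt
  refine ⟨⟨⟨w, h.hom_ext fun x => ?_, h'.hom_ext fun x => ?_⟩⟩⟩
  · exact (hw (i.hom x)).trans (LinearMap.congr_fun ℓ_i x)
  · exact (comm _).trans ((congrArg p (hw x)).trans (LinearMap.congr_fun p_ℓ x))

theorem IsCofree.isFormalManifold (h : IsCofree S π) : IsFormalManifold S :=
  h.isFormalSubmersion isCofree_ground (p := 0) (fun _ => ⟨0, rfl⟩) fun _ => rfl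

end Cofree

section Manifold

variable {k : Type u} [Field k] [CharZero k] {C D S T : CoCom k} {f : C ⟶ D}

theorem IsFormalSubmersion.exists_lift_of_injective (hf : IsFormalSubmersion f) {i : S ⟶ T}
    (hi : Function.Injective i.hom) {u : S ⟶ C} {v : T ⟶ D} (h : u ≫ f = i ≫ v) :
    ∃ w, i ≫ w = u ∧ w ≫ f = v := by
  have := CoCom.hasFiniteLimits (k := k)
  have rlp_snd : (finiteInjections k).rlp (pullback.snd f v) :=
    MorphismProperty.pullback_snd f v hf.rlp
  have lift_snd : pullback.lift u i h ≫ pullback.snd f v = i := pullback.lift_snd _ _ _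
  obtain ⟨s, hs, i_s⟩ := exists_section_comp_eq rlp_snd (u := pullback.lift u i h)
    (by rwa [lift_snd])
  refine ⟨s ≫ pullback.fst f v, ?_, ?_⟩
  · rw [← lift_snd, ← Category.assoc, i_s, pullback.lift_fst]
  · rw [Category.assoc, pullback.condition, ← Category.assoc, hs, Category.id_comp]

theorem IsFormalManifold.isIso [Module.Finite k (Prim C)] (hC : IsFormalManifold C)
    {F : C ⟶ symCo k (Prim C)} (hF : ∀ x : Prim C, symCo.proj k (Prim C) (F.hom x) = x) :
    IsIso F := by
  obtain ⟨r, F_r, -⟩ := IsFormalSubmersion.exists_lift_of_injective hC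
    (CoCom.injective_of_proj_eq hF) (CoCom.groundIsTerminal.hom_ext (𝟙 C ≫ C.counit)
      (F ≫ (symCo k (Prim C)).counit))
  have r_F (x) : r.hom (F.hom x) = x := congrArg (fun m : C ⟶ C => m.hom x) F_r
  have F_proj (y : Prim (symCo k (Prim C))) : Prim.map F (symCo.proj k (Prim C) y) = y := by
    refine sub_eq_zero.1 (Subtype.ext (eq_zero_of_mem_primitives_sym (Submodule.coe_mem _) ?_))
    exact (map_sub _ _ _).trans (sub_eq_zero.2 (hF _))
  have r_prim (y : Prim (symCo k (Prim C))) : Prim.map r y = symCo.proj k (Prim C) y := by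
    nth_rw 1 [← F_proj y]
    exact Subtype.ext (r_F _)
  have injective_r : Function.Injective r.hom :=
    CoCom.injective_of_prim_map_injective (Function.LeftInverse.injective fun y =>
      (congrArg (Prim.map F) (r_prim y)).trans (F_proj y))
  exact ⟨r, F_r, CoCom.hom_ext fun y => injective_r (r_F (r.hom y))⟩

theorem IsFormalManifold.exists_iso (hC : IsFormalManifold C) [Module.Finite k (Prim C)]
    {ℓ : C.carrier →ₗ[k] Prim C} (hℓ : ∀ x : Prim C, ℓ x = x) (ℓ_pt : ℓ C.pt = 0) :
    ∃ e : C ≅ symCo k (Prim C),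
      symCo.proj k (Prim C) ∘ₗ (e.hom.hom : C.carrier →ₗ[k] _) = ℓ := by
  obtain ⟨F, hF⟩ := isCofree_symCo.exists_hom ℓ_pt
  have := hC.isIso fun x => (hF x).trans (hℓ x)
  exact ⟨asIso F, LinearMap.ext hF⟩

theorem IsFormalManifold.isCofree (hC : IsFormalManifold C) {ℓ : C.carrier →ₗ[k] Prim C}
    (hℓ : ∀ x : Prim C, ℓ x = x) (ℓ_pt : ℓ C.pt = 0) : IsCofree C ℓ := by
  have := C.finiteType
  obtain ⟨e, rfl⟩ := hC.exists_iso hℓ ℓ_pt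
  exact isCofree_symCo.of_iso e

theorem isFormalManifold_iff (C : CoCom k) : IsFormalManifold C ↔
    ∃ (V : Type u) (_ : AddCommGroup V) (_ : Module k V) (_ : Module.Finite k V),
      Nonempty (C ≅ symCo k V) := by
  have := C.finiteType
  refine ⟨fun hC => ?_, ?_⟩
  · obtain ⟨ℓ, hℓ, ℓ_pt⟩ := exists_extend_prim (C := C) LinearMap.id
    obtain ⟨e, -⟩ := hC.exists_iso hℓ ℓ_pt
    exact ⟨Prim C, inferInstance, inferInstance, this, ⟨e⟩⟩
  · rintro ⟨V, _, _, _, ⟨e⟩⟩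
    exact (isCofree_symCo.of_iso e).isFormalManifold

theorem isFormalSubmersion_of_prim_surjective (f : C ⟶ D) (hC : IsFormalManifold C)
    (hD : IsFormalManifold D) (hf : Function.Surjective (Prim.map f)) : IsFormalSubmersion f := by
  obtain ⟨b, hb, b_pt⟩ := exists_extend_prim (C := D) LinearMap.id
  obtain ⟨a, ha, a_pt, f_a⟩ := exists_lift_extend_prim hf LinearMap.id
    (b := b ∘ₗ (f.hom : C.carrier →ₗ[k] D.carrier))
    ((congrArg b (CoCom.Hom.map_pt f)).trans b_pt) fun x => (hb (Prim.map f x)).symm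
  exact (hC.isCofree ha a_pt).isFormalSubmersion (hD.isCofree hb b_pt) hf fun x =>
    (LinearMap.congr_fun f_a x).symm

end Manifold

end FormalCoalg

end

theorem mainTheorem9 (k : Type u) [Field k] [CharZero k] :
    -- the coalgebras with the formal submersions form a descent category
    FormalCoalg.IsDescentCategory (FormalCoalg.CoCom k) (FormalCoalg.formalSubmersions k) ∧
    -- formal submersions are surjective on primitives
    (∀ (C D : FormalCoalg.CoCom k) (f : C ⟶ D), FormalCoalg.IsFormalSubmersion f →
      Function.Surjective (FormalCoalg.Prim.map f)) ∧
    -- the formal manifolds are exactly the symmetric coalgebras, and these are cofree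
    ((∀ C : FormalCoalg.CoCom k, FormalCoalg.IsFormalManifold C ↔
        ∃ (V : Type u) (_ : AddCommGroup V) (_ : Module k V) (_ : Module.Finite k V),
          Nonempty (C ≅ FormalCoalg.symCo k V)) ∧
      (∀ (V : Type u) [AddCommGroup V] [Module k V] [Module.Finite k V],
        FormalCoalg.IsCofree (FormalCoalg.symCo k V) (FormalCoalg.symCo.proj k V))) ∧
    -- between formal manifolds, surjectivity on primitives implies formal submersion
    (∀ (C D : FormalCoalg.CoCom k) (f : C ⟶ D), FormalCoalg.IsFormalManifold C →
      FormalCoalg.IsFormalManifold D → Function.Surjective (FormalCoalg.Prim.map f) →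
      FormalCoalg.IsFormalSubmersion f) := by
  exact ⟨FormalCoalg.isDescentCategory, fun _ _ _ hf => hf.prim_surjective,
    ⟨FormalCoalg.isFormalManifold_iff, fun _ => FormalCoalg.isCofree_symCo⟩,
    fun _ _ => FormalCoalg.isFormalSubmersion_of_prim_surjective⟩
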